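/- Conventions. Let $r$ be a non-negative integer, $\mathbb A=\{x\in\mathbb R^r:\sum_i x_i=0\}$ with its Euclidean metric, $W=\mathfrak S_r$ permuting the coordinates, and $W_{\mathrm{aff}}=W\ltimes\mathbb A$ (all translations). Walls are the hyperplanes $x_i-x_j=c$, half-apartments the sets $x_i-x_j\ge c$ ($i\ne j$, $c\in\mathbb R$); the hull of a subset of $\mathbb A$ is the intersection of all half-apartments containing it. Let $\mathcal B$ be an affine building with Weyl group $W_{\mathrm{aff}}$, i.e. a set with a collection of filters (facets) and a collection of subsets (apartments) covering $\mathcal B$, each with a metric, and with an atlas of charts $f:\mathbb A\to\mathcal B$ that are isomorphisms onto the apartments, such that (B1) any two facets lie in a common apartment, and (B2) the intersection of two apartments is a union of facets, and for any two facets in it there is an isomorphism between the two apartments, given in charts by an element of $W_{\mathrm{aff}}$, that fixes the closures of both facets pointwise. For $x,y\in\mathcal B$ the Finsler convex hull $[x,y]_{\mathrm{Fins}}$ is the set of points that, in every apartment containing $x$ and $y$, lie in the hull of $\{x,y\}$. Let $X$ be a Riemann surface, $\phi=(\phi_2,\dots,\phi_r)\in\bigoplus_{k=2}^rH^0(X,\omega_X^{\otimes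 k})$, and let $\lambda_1,\dots,\lambda_r$ be the multivalued 1-form given by the roots of $z^r+\sum_{k=2}^r(-1)^k\phi_kz^{r-k}$. Let $h:X\to\mathcal B$ be harmonic in the sense of Korevaar and Schoen (continuous and locally energy minimizing), and let $X_{\mathrm{reg}}$ be the set of points of $X$ that have a neighbourhood mapped by $h$ into a single apartment. Suppose that $h$ is a $\phi$-map: near every point of $X_{\mathrm{reg}}$ one can write $h=f\circ g$ with a chart $f$ and a differentiable map $g$ to $\mathbb A$ such that, for $2\le k\le r$, $\phi_k$ is the $k$-th elementary symmetric function of the $(1,0)$-forms $2\,\partial(x_i\circ g)$, $i=1,\dots,r$ (the $(1,0)$-forms whose real parts are $g^*dx_i$). A smooth path $\gamma:[0,1]\to X$ is called $\phi$-non-critical if for every $t\in[0,1]$ the $r$ roots of $z^r+\sum_{k=2}^r(-1)^k\phi_k(\dot\gamma(t),\dots,\dot\gamma(t))\,z^{r-k}$, i.e. the numbers $\lambda_i(\dot\gamma(t))$, have pairwise distinct real parts. (1) If $\gamma:[0,1]\to X_{\mathrm{reg}}$ is a $\phi$-non-critical path, then there is an apartment $A\subset\mathcal B$ with $h(\gamma([0,1]))\subset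 A$. (2) Let $P,Q\in X_{\mathrm{reg}}$ and let $\Omega_{PQ}$ be the union of the images of all $\phi$-non-critical paths in $X_{\mathrm{reg}}$ that start at $P$ and end at $Q$. Then $h(\Omega_{PQ})\subset[h(P),h(Q)]_{\mathrm{Fins}}$; in particular there is an apartment containing $h(\Omega_{PQ})$. -/

import Mathlib

open scoped Manifold ContDiff Topology ENNReal
open Set MeasureTheory

noncomputable section

namespace HarmonicBuilding

/-! ### The standard apartment of type `A_{r-1}` -/

/-- The Euclidean space `𝔼 = {x ∈ ℝ^r : x₁ + ⋯ + x_r = 0}`, with the inner product of `ℝ^r`. -/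
def sumZero (r : ℕ) : Submodule ℝ (EuclideanSpace ℝ (Fin r)) where
  carrier := {x | ∑ i, x i = 0}
  add_mem' := by
    intro a b ha hb
    simp only [mem_ofPred_eq] at ha hb ⊢
    simp [Finset.sum_add_distrib, ha, hb]
  zero_mem' := by simp
  smul_mem' := by
    intro c x hx
    simp only [mem_ofPred_eq] at hx ⊢
    simp [← Finset.mul_sum, hx]

/-- The standard apartment `𝔸`: the affine space underlying `𝔼`, with its Euclidean metric. -/
abbrev Apt (r : ℕ) : Type := sumZero r

/-- The linear coordinate `x_i` on the standard apartment. -/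
def coord {r : ℕ} (x : Apt r) (i : Fin r) : ℝ := (x : EuclideanSpace ℝ (Fin r)) i

/-- The affine Weyl group `W ⋉ ℝ^{r-1}`: the permutations of the coordinates composed with all the
translations. -/
def IsWeyl {r : ℕ} (w : Apt r → Apt r) : Prop :=
  ∃ (σ : Equiv.Perm (Fin r)) (t : Apt r), ∀ x i, coord (w x) i = coord x (σ i) + coord t i

/-- Walls: the fixed hyperplanes of the reflections in `W ⋉ ℝ^{r-1}`. -/
def walls (r : ℕ) : Set (Set (Apt r)) :=
  {H | ∃ i j : Fin r, i ≠ j ∧ ∃ c : ℝ, H = {x | coord x i - coord x j = c}}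

/-- Open half-apartments: the connected components of the complements of the walls. -/
def openHalfApts (r : ℕ) : Set (Set (Apt r)) :=
  {H | ∃ i j : Fin r, i ≠ j ∧ ∃ c : ℝ, H = {x | c < coord x i - coord x j}}

/-- Half-apartments: the closures of the open half-apartments. -/
def halfApts (r : ℕ) : Set (Set (Apt r)) :=
  {H | ∃ i j : Fin r, i ≠ j ∧ ∃ c : ℝ, H = {x | c ≤ coord x i - coord x j}}

/-- The vectorial facet that contains the vector `v`: the vectors lying in the same linear walls and
in the same linear open half-apartments as `v`. -/
def vectorialFacet {r : ℕ} (v : Apt r) : Set (Apt r) :=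
  {u | ∀ i j : Fin r, 0 < coord u i - coord u j ↔ 0 < coord v i - coord v j}

/-- The facet based at `x` in the direction of the vectorial facet of `v`: the filter of the sets that
contain a finite intersection of open half-apartments and walls which contains `U ∩ (x + F)` for
some neighbourhood `U` of `x`. -/
def facet {r : ℕ} (x v : Apt r) : Filter (Apt r) :=
  Filter.generate {S | (S ∈ openHalfApts r ∨ S ∈ walls r) ∧
    ∃ U ∈ 𝓝 x, U ∩ ((fun u => x + u) '' vectorialFacet v) ⊆ S}

/-- All facets of the standard apartment. -/
def stdFacets (r : ℕ) : Set (Filter (Apt r)) := {F | ∃ x v : Apt r, F = facet x v}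

/-- Enclosures: intersections of collections of half-apartments. -/
def IsEnclosure {r : ℕ} (S : Set (Apt r)) : Prop := ∃ C ⊆ halfApts r, S = ⋂₀ C

/-- The Finsler convex hull (enclosure) of a subset of the standard apartment. -/
def hull {r : ℕ} (Q : Set (Apt r)) : Set (Apt r) := ⋂₀ {S | IsEnclosure S ∧ Q ⊆ S}

/-! ### Affine buildings -/

/-- An affine building with Weyl group `W ⋉ ℝ^{r-1}`, `W` being the symmetric group on `r` letters:
a set `B` with a collection of filters (facets) and a collection of subsets (apartments), each
apartment having a metric (`aptDist A x y` is meaningful for `x, y ∈ A`), and with an atlas of charts,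
which are isomorphisms from the standard apartment onto the apartments. -/
structure AffineBuilding (r : ℕ) (B : Type*) where
  facets : Set (Filter B)
  apartments : Set (Set B)
  aptDist : Set B → B → B → ℝ
  atlas : Set (Apt r → B)
  /-- every point lies in some apartment -/
  cover : ∀ x : B, ∃ A ∈ apartments, x ∈ A
  /-- (B0) every apartment is isomorphic to the standard one, as a metric space with facets; the
  facets of the apartment `A` are the facets `F` with `A ∈ F` -/
  exists_chart : ∀ A ∈ apartments, ∃ f ∈ atlas, range f = A
  range_chart : ∀ f ∈ atlas, range f ∈ apartments
  chart_injective : ∀ f ∈ atlas, Function.Injective f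
  chart_dist : ∀ f ∈ atlas, ∀ a b, aptDist (range f) (f a) (f b) = dist a b
  chart_facets : ∀ f ∈ atlas, {F ∈ facets | range f ∈ F} = Filter.map f '' stdFacets r
  /-- (B1) any two facets lie in a common apartment (so do their closures, as an apartment is closed
  in itself, and these do not depend on the apartment by (B2)) -/
  exists_apartment : ∀ F ∈ facets, ∀ F' ∈ facets, ∃ A ∈ apartments, A ∈ F ∧ A ∈ F'
  /-- (B2), first part: the intersection of two apartments is a union of facets -/
  inter_facets : ∀ A ∈ apartments, ∀ A' ∈ apartments, ∀ x ∈ A ∩ A',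
    ∃ F ∈ facets, pure x ≤ F ∧ A ∩ A' ∈ F
  /-- (B2), second part: for any two facets in the intersection of two apartments there is an
  isomorphism between the apartments (in the charts: an element `w` of the affine Weyl group) which
  fixes the closures of both facets pointwise -/
  exists_iso : ∀ f ∈ atlas, ∀ g ∈ atlas, ∀ F ∈ facets, ∀ F' ∈ facets,
    range f ∈ F → range g ∈ F → range f ∈ F' → range g ∈ F' →
    ∃ w : Apt r → Apt r, IsWeyl w ∧
      (∃ S, f '' S ∈ F ∧ ∀ a ∈ closure S, g (w a) = f a) ∧
      (∃ S, f '' S ∈ F' ∧ ∀ a ∈ closure S, g (w a) = f a)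

/-- The distance of the building. The set below has exactly one element: two points lie in a common
apartment, and their distance in it does not depend on the apartment. -/
def AffineBuilding.dist {r : ℕ} {B : Type*} (𝓑 : AffineBuilding r B) (x y : B) : ℝ :=
  sInf {δ | ∃ A ∈ 𝓑.apartments, x ∈ A ∧ y ∈ A ∧ δ = 𝓑.aptDist A x y}

/-- The Finsler convex hull `[x, y]_Fins`: the points which, in every apartment containing `x` and
`y`, lie in the hull of `{x, y}` in that apartment. -/
def AffineBuilding.finslerHull {r : ℕ} {B : Type*} (𝓑 : AffineBuilding r B) (x y : B) : Set B :=
  {z | ∀ f ∈ 𝓑.atlas, ∀ a b : Apt r, f a = x → f b = y → z ∈ f '' hull {a, b}}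

/-! ### Holomorphic differentials on a Riemann surface -/

/-- Holomorphic sections of the `k`-th power of the canonical bundle: a holomorphic function `q_z` in
every holomorphic coordinate `z`, such that `q_z(z) dz^k` does not depend on the coordinate. -/
structure HolDifferential (X : Type*) [TopologicalSpace X] [ChartedSpace ℂ X] (k : ℕ) where
  coeff : atlas ℂ X → ℂ → ℂ
  holomorphic : ∀ e : atlas ℂ X, DifferentiableOn ℂ (coeff e) e.1.target
  transform : ∀ e e' : atlas ℂ X, ∀ x ∈ e.1.source ∩ e'.1.source,
    coeff e (e.1 x) = coeff e' (e'.1 x) * deriv (e'.1 ∘ e.1.symm) (e.1 x) ^ k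

/-- The value `q(v, …, v)` at the tangent vector at `x` whose coordinate in the preferred chart at `x`
is `v` (as everywhere in Mathlib, tangent vectors are represented in the preferred chart). -/
def HolDifferential.eval {X : Type*} [TopologicalSpace X] [ChartedSpace ℂ X] {k : ℕ}
    (q : HolDifferential X k) (x : X) (v : ℂ) : ℂ :=
  q.coeff ⟨chartAt ℂ x, chart_mem_atlas ℂ x⟩ (chartAt ℂ x x) * v ^ k

/-- The Hitchin base: tuples `φ = (φ_2, …, φ_r)`, `φ_k` a holomorphic `k`-differential. -/
abbrev HitchinBase (X : Type*) [TopologicalSpace X] [ChartedSpace ℂ X] (r : ℕ) : Type _ :=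
  ∀ k : Finset.Icc 2 r, HolDifferential X k

/-- The characteristic polynomial `z^r + ∑_{k=2}^r (-1)^k φ_k(v, …, v) z^{r-k}`. Its roots are the
values `λ_1(v), …, λ_r(v)` of the multivalued 1-form whose `k`-th elementary symmetric function
is `φ_k`. -/
def charPoly {X : Type*} [TopologicalSpace X] [ChartedSpace ℂ X] {r : ℕ} (φ : HitchinBase X r)
    (x : X) (v : ℂ) : Polynomial ℂ :=
  Polynomial.X ^ r + ∑ k : Finset.Icc 2 r,
    Polynomial.C ((-1) ^ (k : ℕ) * (φ k).eval x v) * Polynomial.X ^ (r - (k : ℕ))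

/-- The velocity at time `t` of a path defined on `[0, 1]`, in the preferred chart at `γ t`. -/
def velocity {X : Type*} [TopologicalSpace X] [ChartedSpace ℂ X] (γ : ℝ → X) (t : ℝ) : ℂ :=
  derivWithin (fun s => chartAt ℂ (γ t) (γ s)) (Icc 0 1) t

/-- `γ`, restricted to `[0, 1]`, is a `φ`-non-critical path: it is smooth, and at each time the `r`
roots of the characteristic polynomial at its velocity have pairwise distinct real parts. -/
structure IsNonCritical {X : Type*} [TopologicalSpace X] [ChartedSpace ℂ X] {r : ℕ}
    (φ : HitchinBase X r) (γ : ℝ → X) : Prop where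
  smooth : ContMDiffOn 𝓘(ℝ, ℝ) 𝓘(ℝ, ℂ) ∞ γ (Icc 0 1)
  distinct : ∀ t ∈ Icc (0 : ℝ) 1,
    ((charPoly φ (γ t) (velocity γ t)).roots.map Complex.re).Nodup

/-! ### Harmonic maps (Korevaar-Schoen) -/

/-- The Korevaar-Schoen energy on an open set `Ω` of the plane of a map `u` into a space with distance
`d` (up to a universal factor): the supremum over continuous cut-off functions `0 ≤ η ≤ 1` with
compact support in `Ω` of `limsup_{ε → 0} ∫ η(x) (∫_{|y-x|<ε} d(u(x),u(y))² dy / ε⁴) dx`. -/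
def ksEnergy {B : Type*} (d : B → B → ℝ) (Ω : Set ℂ) (u : ℂ → B) : ℝ≥0∞ :=
  ⨆ (η : ℂ → ℝ) (_ : Continuous η ∧ HasCompactSupport η ∧ tsupport η ⊆ Ω ∧
      ∀ x, 0 ≤ η x ∧ η x ≤ 1),
    Filter.limsup (fun ε : ℝ => ∫⁻ x : ℂ, ENNReal.ofReal (η x) *
      ∫⁻ y in Metric.ball x ε, ENNReal.ofReal (d (u x) (u y) ^ 2 / ε ^ 4)) (𝓝[>] 0)

/-- `u ∈ L²(Ω, B)`: almost everywhere measurable and separably valued, with square integrable distance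
to a point. -/
structure IsL2Map {B : Type*} (d : B → B → ℝ) (Ω : Set ℂ) (u : ℂ → B) : Prop where
  measurable : ∀ p, AEMeasurable (fun x => d (u x) p) (volume.restrict Ω)
  separable : ∃ S : Set B, S.Countable ∧
    ∀ᵐ x ∂(volume.restrict Ω), ∀ δ > 0, ∃ s ∈ S, d (u x) s < δ
  integrable : ∀ p, ∫⁻ x in Ω, ENNReal.ofReal (d (u x) p ^ 2) < ⊤

/-- Harmonic maps from a Riemann surface to a building: continuous maps of locally finite energy that
are locally energy minimizing, i.e. around every point there is a coordinate disc on which the map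
has the smallest energy among all the maps that agree with it off a compact subset of the disc.
(In dimension two the energy is conformally invariant, so it can be computed in coordinates.) -/
structure AffineBuilding.IsHarmonic {X : Type*} [TopologicalSpace X] [ChartedSpace ℂ X] {r : ℕ}
    {B : Type*} (𝓑 : AffineBuilding r B) (h : X → B) : Prop where
  continuous : ∀ x, Filter.Tendsto (fun y => 𝓑.dist (h x) (h y)) (𝓝 x) (𝓝 0)
  minimizing : ∀ x, ∃ ρ > 0,
    Metric.closedBall (chartAt ℂ x x) ρ ⊆ (chartAt ℂ x).target ∧
    ksEnergy 𝓑.dist (Metric.ball (chartAt ℂ x x) ρ) (h ∘ (chartAt ℂ x).symm) < ⊤ ∧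
    ∀ v : ℂ → B, IsL2Map 𝓑.dist (Metric.ball (chartAt ℂ x x) ρ) v →
      (∃ K, IsCompact K ∧ K ⊆ Metric.ball (chartAt ℂ x x) ρ ∧
        ∀ z ∈ Metric.ball (chartAt ℂ x x) ρ \ K, v z = h ((chartAt ℂ x).symm z)) →
      ksEnergy 𝓑.dist (Metric.ball (chartAt ℂ x x) ρ) (h ∘ (chartAt ℂ x).symm) ≤
        ksEnergy 𝓑.dist (Metric.ball (chartAt ℂ x x) ρ) v

/-! ### Harmonic `φ`-maps -/

/-- The regular locus of `h`: the points with a neighbourhood mapped into a single apartment. -/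
def AffineBuilding.regularLocus {X : Type*} [TopologicalSpace X] {r : ℕ} {B : Type*}
    (𝓑 : AffineBuilding r B) (h : X → B) : Set X :=
  {x | ∃ U ∈ 𝓝 x, ∃ A ∈ 𝓑.apartments, h '' U ⊆ A}

/-- For a map `g` to the standard apartment, the value at a tangent vector `v` at `x` of the complex
`(1,0)`-form `2 ∂(x_i ∘ g)`, whose real part is `g^* dx_i`. -/
def formOf {X : Type*} [TopologicalSpace X] [ChartedSpace ℂ X] {r : ℕ} (g : X → Apt r) (x : X)
    (v : ℂ) (i : Fin r) : ℂ :=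
  (coord (fderiv ℝ (g ∘ (chartAt ℂ x).symm) (chartAt ℂ x x) v) i : ℂ) -
    Complex.I * (coord (fderiv ℝ (g ∘ (chartAt ℂ x).symm) (chartAt ℂ x x) (Complex.I * v)) i : ℂ)

/-- On the regular locus the pullbacks by `h` of the symmetric tensors `σ_k(dx_1, …, dx_r)` are the
`φ_k`: locally `h = f ∘ g` with a chart `f` and a differentiable `g`, and `φ_k` is the `k`-th
elementary symmetric function of the `(1,0)`-forms of which the `g^* dx_i` are the real parts. -/
def AffineBuilding.IsPhiMap {X : Type*} [TopologicalSpace X] [ChartedSpace ℂ X] {r : ℕ} {B : Type*}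
    (𝓑 : AffineBuilding r B) (φ : HitchinBase X r) (h : X → B) : Prop :=
  ∀ x ∈ 𝓑.regularLocus h, ∃ U ∈ 𝓝 x, ∃ f ∈ 𝓑.atlas, ∃ g : X → Apt r, ∀ y ∈ U,
    h y = f (g y) ∧
    DifferentiableAt ℝ (g ∘ (chartAt ℂ y).symm) (chartAt ℂ y y) ∧
    ∀ (k : Finset.Icc 2 r) (v : ℂ),
      (φ k).eval y v =
        ∑ s ∈ Finset.powersetCard (k : ℕ) (Finset.univ : Finset (Fin r)), ∏ i ∈ s, formOf g y v i

/-- Harmonic `φ`-maps. -/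
structure AffineBuilding.IsHarmonicPhiMap {X : Type*} [TopologicalSpace X] [ChartedSpace ℂ X]
    {r : ℕ} {B : Type*} (𝓑 : AffineBuilding r B) (φ : HitchinBase X r) (h : X → B) : Prop where
  harmonic : 𝓑.IsHarmonic h
  phiMap : 𝓑.IsPhiMap φ h

/-- `Ω_{PQ}`: the union of the images of the `φ`-non-critical paths from `P` to `Q` in the regular
locus of `h`. -/
def AffineBuilding.nonCriticalRegion {X : Type*} [TopologicalSpace X] [ChartedSpace ℂ X]
    {r : ℕ} {B : Type*} (𝓑 : AffineBuilding r B) (φ : HitchinBase X r) (h : X → B) (P Q : X) :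
    Set X :=
  {R | ∃ γ : ℝ → X, IsNonCritical φ γ ∧ (∀ t ∈ Icc (0 : ℝ) 1, γ t ∈ 𝓑.regularLocus h) ∧
    γ 0 = P ∧ γ 1 = Q ∧ R ∈ γ '' Icc 0 1}

end HarmonicBuilding

end

/-! In a local apartment, the derivatives of the coordinates of h∘γ are the real parts of the
numbers λ_i(γ'). On a non-critical path these never coincide, so after one reordering of the
coordinates all increments of h∘γ near a given time lie in the open dominant chamber
(`IsPhiMap.exists_isDominantOn`). The rest is building geometry: a path that is locally dominant in
this sense lies in a single apartment and is dominant there (`exists_isDominantOn_of_local`).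

Two facts carry this. The first is convexity (`IsChart.eq_of_between`): charts that agree at a and b
agree at every z for which z - a and b - z are dominant. Retract onto an apartment from a chamber
germ at z. By the rearrangement inequality the retraction does not increase the pairing of a
dominant displacement with a decreasing weight. The bounds for a → z and z → b add up to an
equality, which forces the retraction to preserve the position of z.

The second is rigidity: an element of the affine Weyl group is determined by its values on a chamber
germ, and (B2) provides one element for two germs at once. Continuous induction along [0,1] then
glues the local pieces. An apartment containing the start of the path and a one-sided chamber germ
at time t contains the earlier part by convexity, and rigidity excludes a fold at the junction.

Along a dominant path every difference of coordinates is monotone, so the path stays in the hull of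
its endpoints in every apartment containing both (`IsDominantOn.mem_finslerHull`). -/

namespace HarmonicBuilding

open Filter

/-! ### Coordinates on the standard apartment -/

section Coordinates

variable {r : ℕ}

@[simp] lemma coord_add (x y : Apt r) (i : Fin r) : coord (x + y) i = coord x i + coord y i := rfl

@[simp] lemma coord_sub (x y : Apt r) (i : Fin r) : coord (x - y) i = coord x i - coord y i := rfl

@[simp] lemma coord_neg (x : Apt r) (i : Fin r) : coord (-x) i = -coord x i := rfl

@[simp] lemma coord_smul (c : ℝ) (x : Apt r) (i : Fin r) : coord (c • x) i = c * coord x i := rfl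

@[simp] lemma coord_zero (i : Fin r) : coord (0 : Apt r) i = 0 := rfl

lemma apt_ext {x y : Apt r} (h : ∀ i, coord x i = coord y i) : x = y :=
  Subtype.ext (PiLp.ext h)

lemma sum_coord (x : Apt r) : ∑ i, coord x i = 0 := x.2

/-- The point of the standard apartment with given coordinates. -/
def aptOf (x : Fin r → ℝ) (hx : ∑ i, x i = 0) : Apt r := ⟨WithLp.toLp 2 x, hx⟩

@[simp] lemma coord_aptOf (x : Fin r → ℝ) (hx : ∑ i, x i = 0) (i : Fin r) :
    coord (aptOf x hx) i = x i := rfl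

lemma tendsto_apt_iff {α : Type*} {l : Filter α} {u : α → Apt r} {x : Apt r} :
    Tendsto u l (𝓝 x) ↔ ∀ i, Tendsto (fun a => coord (u a) i) l (𝓝 (coord x i)) := by
  rw [tendsto_subtype_rng]
  have : (fun a => (u a : EuclideanSpace ℝ (Fin r))) =
      WithLp.toLp 2 ∘ fun a => (u a : EuclideanSpace ℝ (Fin r)).ofLp := rfl
  rw [this]
  constructor
  · intro h i
    exact ((PiLp.continuous_apply 2 _ i).tendsto _).comp h
  · intro h
    exact ((PiLp.continuous_toLp 2 _).tendsto _).comp (tendsto_pi_nhds.2 h)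

lemma continuous_coord (i : Fin r) : Continuous fun x : Apt r => coord x i :=
  continuous_iff_continuousAt.2 fun _ => tendsto_apt_iff.1 tendsto_id i

lemma coord_eq_sum_sub (x : Apt r) (i : Fin r) :
    coord x i = (r : ℝ)⁻¹ * ∑ j, (coord x i - coord x j) := by
  have hr : (r : ℝ) ≠ 0 := by
    have := i.pos
    positivity
  rw [Finset.sum_sub_distrib, sum_coord]
  simp [hr]

lemma exists_strictAnti_coord (r : ℕ) : ∃ δ : Apt r, StrictAnti (coord δ) := by
  rcases Nat.eq_zero_or_pos r with rfl | hr
  · exact ⟨0, fun i => i.elim0⟩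
  · refine ⟨aptOf (fun i => (r : ℝ)⁻¹ * (∑ j : Fin r, (j : ℝ)) - (i : ℝ)) ?_, ?_⟩
    · have : (r : ℝ) ≠ 0 := by positivity
      simp [Finset.sum_sub_distrib, this]
    · intro i j hij
      have : (i : ℝ) < (j : ℝ) := by exact_mod_cast hij
      simpa using this

end Coordinates

/-! ### The affine Weyl group -/

section Weyl

variable {r : ℕ} {w w' : Apt r → Apt r}

lemma isWeyl_id : IsWeyl (id : Apt r → Apt r) := ⟨1, 0, by simp⟩

lemma IsWeyl.comp (h : IsWeyl w) (h' : IsWeyl w') : IsWeyl (w ∘ w') := by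
  obtain ⟨σ, t, h⟩ := h
  obtain ⟨σ', t', h'⟩ := h'
  -- The difference `w t' - w 0` is the linear part of `w` applied to `t'`.
  refine ⟨σ' * σ, w t' - w 0 + t, fun x i => ?_⟩
  simp only [Function.comp, h, h', coord_add, coord_sub, coord_zero, Equiv.Perm.mul_apply]
  ring

lemma isWeyl_perm (σ : Equiv.Perm (Fin r)) :
    ∃ w : Apt r → Apt r, IsWeyl w ∧ ∀ x i, coord (w x) i = coord x (σ i) :=
  ⟨fun x => aptOf (fun i => coord x (σ i)) ((Equiv.sum_comp σ _).trans (sum_coord x)),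
    ⟨σ, 0, by simp⟩, fun _ _ => rfl⟩

lemma IsWeyl.exists_inverse (h : IsWeyl w) :
    ∃ w', IsWeyl w' ∧ (∀ x, w' (w x) = x) ∧ ∀ x, w (w' x) = x := by
  obtain ⟨σ, t, h⟩ := h
  obtain ⟨p, ⟨τ, s, hp'⟩, hp⟩ := isWeyl_perm (σ⁻¹)
  refine ⟨fun x => p (x - t), ⟨σ⁻¹, -p t, fun x i => ?_⟩, fun x => apt_ext fun i => ?_,
    fun x => apt_ext fun i => ?_⟩
  · simp [hp, sub_eq_add_neg]
  · simp [hp, h]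
  · simp [hp, h]

lemma IsWeyl.injective (h : IsWeyl w) : Function.Injective w := by
  obtain ⟨w', -, h', -⟩ := h.exists_inverse
  exact Function.LeftInverse.injective h'

lemma IsWeyl.surjective (h : IsWeyl w) : Function.Surjective w := by
  obtain ⟨w', -, -, h'⟩ := h.exists_inverse
  exact Function.RightInverse.surjective h'

lemma IsWeyl.continuous (h : IsWeyl w) : Continuous w := by
  obtain ⟨σ, t, h⟩ := h
  refine continuous_iff_continuousAt.2 fun x => tendsto_apt_iff.2 fun i => ?_
  simp only [h]
  exact ((continuous_coord (σ i)).tendsto x).add_const _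

/-- An element of the affine Weyl group which maps one vector with strictly decreasing coordinates to
another one is a translation. -/
lemma IsWeyl.eq_add_of_strictAnti (h : IsWeyl w) {x y : Apt r} (hxy : StrictAnti (coord (y - x)))
    (hw : StrictAnti (coord (w y - w x))) : ∃ t, ∀ z, w z = z + t := by
  obtain ⟨σ, t, h⟩ := h
  have hσ : StrictMono σ := by
    intro i j hij
    have := hw hij
    simp only [coord_sub, h] at this
    refine hxy.lt_iff_gt.1 ?_
    simp only [coord_sub]
    linarith
  have h1 : ∀ i, σ i = i := by
    intro i
    -- The only order automorphism of `Fin r` is the identity.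
    have e : hσ.orderIsoOfSurjective σ σ.surjective = OrderIso.refl _ := Subsingleton.elim _ _
    exact congrArg (fun f : Fin r ≃o Fin r => f i) e
  exact ⟨t, fun z => apt_ext fun i => by simp [h, h1]⟩

end Weyl

/-! ### Facets as germs -/

section Germ

variable {r : ℕ}

lemma self_mem_vectorialFacet (v : Apt r) : v ∈ vectorialFacet v := fun _ _ => Iff.rfl

lemma smul_mem_vectorialFacet {v u : Apt r} (hu : u ∈ vectorialFacet v) {s : ℝ} (hs : 0 < s) :
    s • u ∈ vectorialFacet v := by
  intro i j
  rw [← hu i j, coord_smul, coord_smul, ← mul_sub, mul_pos_iff_of_pos_left hs]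

lemma mem_vectorialFacet_of_strictAnti {v u : Apt r} (hv : StrictAnti (coord v))
    (hu : StrictAnti (coord u)) : u ∈ vectorialFacet v := by
  intro i j
  rw [sub_pos, sub_pos, hv.lt_iff_gt, hu.lt_iff_gt]

lemma strictAnti_of_mem_vectorialFacet {v u : Apt r} (hv : StrictAnti (coord v))
    (hu : u ∈ vectorialFacet v) : StrictAnti (coord u) := by
  intro i j hij
  exact sub_pos.1 ((hu i j).2 (sub_pos.2 (hv hij)))

lemma neg_mem_vectorialFacet_neg {v u : Apt r} (hu : u ∈ vectorialFacet v) :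
    -u ∈ vectorialFacet (-v) := by
  intro i j
  have := hu j i
  simp only [coord_neg]
  constructor <;> intro h
  · linarith [this.1 (by linarith)]
  · linarith [this.2 (by linarith)]

/-- Differences of coordinates determine a point, so half-apartments around `x` already generate its
neighbourhoods; those bounded by walls through `x`, together with these walls, cut out the cone `x +
F`. Facets thus become ordinary germs of cones. -/
lemma facet_eq_nhdsWithin (x v : Apt r) :
    facet x v = 𝓝[(fun u => x + u) '' vectorialFacet v] x := by
  have half : ∀ i j : Fin r, i ≠ j → ∀ c : ℝ, (c < coord x i - coord x j ∨
      (c ≤ coord x i - coord x j ∧ 0 < coord v i - coord v j)) →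
      ∀ᶠ y in facet x v, c < coord y i - coord y j := by
    intro i j hij c hc
    refine GenerateSets.basic ⟨Or.inl ⟨i, j, hij, c, rfl⟩, ?_⟩
    rcases hc with hc | ⟨hc, hv⟩
    · refine ⟨{y | c < coord y i - coord y j}, ?_, inter_subset_left⟩
      exact ((continuous_coord i).sub (continuous_coord j)).tendsto x |>.eventually
        (lt_mem_nhds hc)
    · refine ⟨univ, univ_mem, ?_⟩
      rintro _ ⟨-, u, hu, rfl⟩
      have := (hu i j).2 hv
      simp only [mem_ofPred_eq, coord_add]
      linarith
  apply le_antisymm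
  · refine le_inf ?_ ?_
    · refine tendsto_id'.1 (tendsto_apt_iff.2 fun i => ?_)
      simp only [id]
      have : (fun y : Apt r => coord y i) =
          fun y => (r : ℝ)⁻¹ * ∑ j, (coord y i - coord y j) := funext fun y => coord_eq_sum_sub y i
      rw [this, coord_eq_sum_sub x i]
      refine Tendsto.const_mul _ (tendsto_finsetSum _ fun j _ => ?_)
      rcases eq_or_ne i j with rfl | hij
      · simpa using tendsto_const_nhds
      refine tendsto_order.2 ⟨fun a ha => half i j hij a (Or.inl ha), fun a ha => ?_⟩
      filter_upwards [half j i hij.symm (-a) (Or.inl (by linarith))] with y hy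
      linarith
    · have key : ∀ᶠ y in facet x v, ∀ i j, 0 < coord (y - x) i - coord (y - x) j ↔
          0 < coord v i - coord v j := by
        refine eventually_all.2 fun i => eventually_all.2 fun j => ?_
        rcases eq_or_ne i j with rfl | hij
        · simp
        rcases lt_trichotomy 0 (coord v i - coord v j) with h | h | h
        · filter_upwards [half i j hij _ (Or.inr ⟨le_rfl, h⟩)] with y hy
          simp only [coord_sub]
          exact iff_of_true (by linarith) h
        · have : {y : Apt r | coord y i - coord y j = coord x i - coord x j} ∈ facet x v := by
            refine GenerateSets.basic ⟨Or.inr ⟨i, j, hij, _, rfl⟩, univ, univ_mem, ?_⟩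
            rintro _ ⟨-, u, hu, rfl⟩
            have h1 := hu i j
            have h2 := hu j i
            rw [← h] at h1
            rw [show coord v j - coord v i = 0 by linarith] at h2
            simp only [lt_self_iff_false, iff_false, not_lt] at h1 h2
            simp only [mem_ofPred_eq, coord_add]
            linarith
          filter_upwards [this] with y hy
          simp only [coord_sub]
          exact iff_of_false (by linarith) (by linarith)
        · filter_upwards [half j i hij.symm _ (Or.inr ⟨le_rfl, by linarith⟩)] with y hy
          simp only [coord_sub]
          exact iff_of_false (by linarith) (by linarith)
      refine le_principal_iff.2 (key.mono fun y hy => ⟨y - x, hy, by simp⟩)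
  · refine le_generate_iff.2 ?_
    rintro S ⟨-, U, hU, hS⟩
    exact mem_nhdsWithin_iff_exists_mem_nhds_inter.2 ⟨U, hU, hS⟩

lemma tendsto_facet_iff {α : Type*} {l : Filter α} {g : α → Apt r} {x v : Apt r} :
    Tendsto g l (facet x v) ↔ Tendsto g l (𝓝 x) ∧ ∀ᶠ a in l, g a - x ∈ vectorialFacet v := by
  rw [facet_eq_nhdsWithin, tendsto_nhdsWithin_iff]
  refine and_congr_right fun _ => eventually_congr (Eventually.of_forall fun a => ?_)
  simp only [mem_image]
  constructor
  · rintro ⟨u, hu, h⟩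
    rwa [← h, add_sub_cancel_left]
  · intro h
    exact ⟨_, h, by simp⟩

lemma tendsto_ray (x v : Apt r) :
    Tendsto (fun s : ℝ => x + s • v) (𝓝[>] 0) (facet x v) := by
  refine tendsto_facet_iff.2 ⟨?_, ?_⟩
  · have : Tendsto (fun s : ℝ => x + s • v) (𝓝 0) (𝓝 (x + (0 : ℝ) • v)) :=
      Continuous.tendsto (by fun_prop) 0
    rw [zero_smul, add_zero] at this
    exact this.mono_left nhdsWithin_le_nhds
  · filter_upwards [self_mem_nhdsWithin] with s hs
    rw [add_sub_cancel_left]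
    exact smul_mem_vectorialFacet (self_mem_vectorialFacet v) hs

/-- The germ of a facet together with its base point. -/
def germ (x v : Apt r) : Filter (Apt r) := pure x ⊔ facet x v

lemma eventually_germ {x v : Apt r} {p : Apt r → Prop} :
    (∀ᶠ a in germ x v, p a) ↔ p x ∧ ∀ᶠ a in facet x v, p a := by
  rw [germ, eventually_sup, eventually_pure]

/-- The vectorial facet of 0 is {0}, since equal coordinates with sum zero vanish. Direction 0
therefore lets the axioms (B1) and (B2) be applied to single points. -/
lemma eventually_germ_zero {x : Apt r} {p : Apt r → Prop} (h : p x) :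
    ∀ᶠ a in germ x 0, p a := by
  refine eventually_germ.2 ⟨h, ?_⟩
  have : ∀ᶠ a in facet x 0, a - x ∈ vectorialFacet 0 := (tendsto_facet_iff.1 tendsto_id).2
  filter_upwards [this] with a ha
  have : a = x := by
    refine apt_ext fun i => ?_
    have h1 : ∀ j, coord (a - x) i - coord (a - x) j = 0 := by
      intro j
      have h1 := ha i j
      have h2 := ha j i
      simp only [coord_zero, sub_zero, lt_self_iff_false, iff_false, not_lt] at h1 h2
      linarith
    have h2 := coord_eq_sum_sub (a - x) i
    rw [Finset.sum_congr rfl fun j _ => h1 j, coord_sub] at h2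
    simp only [Finset.sum_const_zero, mul_zero] at h2
    linarith
  rwa [this]

lemma mem_closure_of_mem_facet {x v : Apt r} {S : Set (Apt r)} (hS : S ∈ facet x v) :
    x ∈ closure S := by
  have h := tendsto_ray x v
  have h2 : Tendsto (fun s : ℝ => x + s • v) (𝓝[>] 0) (𝓝 x) := (tendsto_facet_iff.1 h).1
  exact mem_closure_of_tendsto h2 (h hS)

lemma eventually_ray {x v : Apt r} {p : Apt r → Prop} (h : ∀ᶠ a in germ x v, p a) :
    ∃ ε : ℝ, 0 < ε ∧ ∀ s : ℝ, 0 ≤ s → s < ε → p (x + s • v) := by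
  obtain ⟨h0, h1⟩ := eventually_germ.1 h
  obtain ⟨ε, hε, h2⟩ := mem_nhdsGT_iff_exists_Ioo_subset.1 ((tendsto_ray x v).eventually h1)
  refine ⟨ε, hε, fun s hs hs' => ?_⟩
  rcases hs.eq_or_lt with rfl | hs
  · simpa using h0
  · exact h2 ⟨hs, hs'⟩

lemma IsWeyl.tendsto_facet {w : Apt r → Apt r} (hw : IsWeyl w) (x v : Apt r) :
    Tendsto w (facet x v) (facet (w x) (w (x + v) - w x)) := by
  have h0 := tendsto_facet_iff.1 (tendsto_id (x := facet x v))
  refine tendsto_facet_iff.2 ⟨(hw.continuous.tendsto x).comp h0.1, ?_⟩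
  filter_upwards [h0.2] with a ha i j
  obtain ⟨σ, t, h⟩ := hw
  have := ha (σ i) (σ j)
  simpa [h] using this

lemma IsWeyl.tendsto_germ {w : Apt r → Apt r} (hw : IsWeyl w) (x v : Apt r) :
    Tendsto w (germ x v) (germ (w x) (w (x + v) - w x)) :=
  Tendsto.sup_sup (tendsto_pure_pure w x) (hw.tendsto_facet x v)

/-- Two elements of the affine Weyl group that agree on the germ of a chamber are equal. -/
lemma IsWeyl.eq_of_eventually {w w' : Apt r → Apt r} (hw : IsWeyl w) (hw' : IsWeyl w')
    {x v : Apt r} (hv : Function.Injective (coord v)) (h : ∀ᶠ a in germ x v, w a = w' a) :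
    w = w' := by
  obtain ⟨ε, hε, h⟩ := eventually_ray h
  obtain ⟨σ, t, hw⟩ := hw
  obtain ⟨σ', t', hw'⟩ := hw'
  have h0 := h 0 le_rfl hε
  have h1 := h (ε / 2) (by positivity) (by linarith)
  have h2 : ∀ i, σ i = σ' i := by
    intro i
    have e0 := congrArg (fun z => coord z i) h0
    have e1 := congrArg (fun z => coord z i) h1
    simp only [hw, hw', coord_add, coord_smul] at e0 e1
    apply hv
    have : (ε / 2) * coord v (σ i) = (ε / 2) * coord v (σ' i) := by linarith
    exact mul_left_cancel₀ (by positivity) this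
  funext z
  refine apt_ext fun i => ?_
  have e0 := congrArg (fun z => coord z i) h0
  simp only [hw, hw', coord_add, coord_smul, h2] at e0 ⊢
  linarith

end Germ

/-! ### Charts of a building -/

section Charts

variable {r : ℕ} {B : Type*} {𝓑 : AffineBuilding r B}

/-- The charts of a building: those of the atlas, composed with the affine Weyl group. -/
def AffineBuilding.IsChart (𝓑 : AffineBuilding r B) (f : Apt r → B) : Prop :=
  ∃ f₀ ∈ 𝓑.atlas, ∃ w, IsWeyl w ∧ f = f₀ ∘ w

lemma AffineBuilding.isChart_of_mem_atlas {f : Apt r → B} (hf : f ∈ 𝓑.atlas) : 𝓑.IsChart f :=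
  ⟨f, hf, id, isWeyl_id, rfl⟩

namespace AffineBuilding.IsChart

lemma comp_weyl {f : Apt r → B} (hf : 𝓑.IsChart f) {w : Apt r → Apt r} (hw : IsWeyl w) :
    𝓑.IsChart (f ∘ w) := by
  obtain ⟨f₀, hf₀, w₀, hw₀, rfl⟩ := hf
  exact ⟨f₀, hf₀, w₀ ∘ w, hw₀.comp hw, rfl⟩

lemma injective {f : Apt r → B} (hf : 𝓑.IsChart f) : Function.Injective f := by
  obtain ⟨f₀, hf₀, w₀, hw₀, rfl⟩ := hf
  exact (𝓑.chart_injective f₀ hf₀).comp hw₀.injective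

lemma range_mem {f : Apt r → B} (hf : 𝓑.IsChart f) : range f ∈ 𝓑.apartments := by
  obtain ⟨f₀, hf₀, w₀, hw₀, rfl⟩ := hf
  rw [hw₀.surjective.range_comp]
  exact 𝓑.range_chart f₀ hf₀

end AffineBuilding.IsChart

lemma AffineBuilding.map_facet_mem {f : Apt r → B} (hf : f ∈ 𝓑.atlas) (x v : Apt r) :
    Filter.map f (facet x v) ∈ 𝓑.facets :=
  ((𝓑.chart_facets f hf).symm.subset ⟨_, ⟨x, v, rfl⟩, rfl⟩ :
    Filter.map f (facet x v) ∈ {F ∈ 𝓑.facets | range f ∈ F}).1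

/-- This is (B2) in terms of germs. The base point lies in the closure of every set of the facet, so
fixing closures gives agreement at the base point too. -/
lemma AffineBuilding.exists_weyl_of_mem_atlas {f g : Apt r → B} (hf : f ∈ 𝓑.atlas)
    (hg : g ∈ 𝓑.atlas) {x v x' v' : Apt r} (h : ∀ᶠ a in facet x v, f a ∈ range g)
    (h' : ∀ᶠ a in facet x' v', f a ∈ range g) :
    ∃ w, IsWeyl w ∧ (∀ᶠ a in germ x v, f a = g (w a)) ∧ ∀ᶠ a in germ x' v', f a = g (w a) := by
  obtain ⟨w, hw, ⟨S, hS, hS'⟩, T, hT, hT'⟩ := 𝓑.exists_iso f hf g hg _ (𝓑.map_facet_mem hf x v) _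
    (𝓑.map_facet_mem hf x' v') (mem_map.2 (Eventually.of_forall fun a => mem_range_self a)) h
    (mem_map.2 (Eventually.of_forall fun a => mem_range_self a)) h'
  have key : ∀ {y u : Apt r} {S : Set (Apt r)}, f '' S ∈ Filter.map f (facet y u) →
      (∀ a ∈ closure S, g (w a) = f a) → ∀ᶠ a in germ y u, f a = g (w a) := by
    intro y u S hS hS'
    have hS : S ∈ facet y u := by
      rw [mem_map, preimage_image_eq _ (𝓑.chart_injective f hf)] at hS
      exact hS
    exact eventually_germ.2 ⟨(hS' _ (mem_closure_of_mem_facet hS)).symm,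
      mem_of_superset hS fun a ha => (hS' a (subset_closure ha)).symm⟩
  exact ⟨w, hw, key hS hS', key hT hT'⟩

lemma AffineBuilding.IsChart.exists_weyl {f g : Apt r → B} (hf : 𝓑.IsChart f) (hg : 𝓑.IsChart g)
    {x v x' v' : Apt r} (h : ∀ᶠ a in germ x v, f a ∈ range g)
    (h' : ∀ᶠ a in germ x' v', f a ∈ range g) :
    ∃ w, IsWeyl w ∧ (∀ᶠ a in germ x v, f a = g (w a)) ∧ ∀ᶠ a in germ x' v', f a = g (w a) := by
  obtain ⟨f₀, hf₀, p, hp, rfl⟩ := hf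
  obtain ⟨g₀, hg₀, q, hq, rfl⟩ := hg
  obtain ⟨p', hp', hpl, hpr⟩ := hp.exists_inverse
  obtain ⟨q', hq', hql, hqr⟩ := hq.exists_inverse
  have key : ∀ {y u : Apt r}, (∀ᶠ a in germ y u, (f₀ ∘ p) a ∈ range (g₀ ∘ q)) →
      ∀ᶠ a in facet (p y) (p (y + u) - p y), f₀ a ∈ range g₀ := by
    intro y u hyu
    have ht := hp'.tendsto_facet (p y) (p (y + u) - p y)
    rw [add_sub_cancel, hpl, hpl, add_sub_cancel_left] at ht
    filter_upwards [ht.eventually (eventually_germ.1 hyu).2] with a ha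
    simp only [Function.comp, hpr] at ha
    exact range_comp_subset_range q g₀ ha
  obtain ⟨w, hw, h1, h2⟩ := exists_weyl_of_mem_atlas hf₀ hg₀ (key h) (key h')
  refine ⟨q' ∘ w ∘ p, hq'.comp (hw.comp hp), ?_, ?_⟩
  · filter_upwards [(hp.tendsto_germ x v).eventually h1] with a ha
    simp [hqr, ha]
  · filter_upwards [(hp.tendsto_germ x' v').eventually h2] with a ha
    simp [hqr, ha]

/-- (B1) places only the facets in a common apartment; the base points are recovered from the
closures in (B2). -/
lemma AffineBuilding.exists_chart_of_mem_atlas {f f' : Apt r → B} (hf : f ∈ 𝓑.atlas)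
    (hf' : f' ∈ 𝓑.atlas) (x v x' v' : Apt r) :
    ∃ g ∈ 𝓑.atlas, (∀ᶠ a in germ x v, f a ∈ range g) ∧ ∀ᶠ a in germ x' v', f' a ∈ range g := by
  obtain ⟨A, hA, h, h'⟩ := 𝓑.exists_apartment _ (𝓑.map_facet_mem hf x v) _
    (𝓑.map_facet_mem hf' x' v')
  obtain ⟨g, hg, rfl⟩ := 𝓑.exists_chart A hA
  refine ⟨g, hg, ?_, ?_⟩
  · obtain ⟨w, -, hw, -⟩ := exists_weyl_of_mem_atlas hf hg h h
    exact hw.mono fun a ha => ⟨_, ha.symm⟩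
  · obtain ⟨w, -, hw, -⟩ := exists_weyl_of_mem_atlas hf' hg h' h'
    exact hw.mono fun a ha => ⟨_, ha.symm⟩

/-- Two germs are contained in a common chart, which can be chosen to agree with a given one on the
first germ. -/
lemma AffineBuilding.IsChart.exists_common {f f' : Apt r → B} (hf : 𝓑.IsChart f)
    (hf' : 𝓑.IsChart f') (x v x' v' : Apt r) :
    ∃ g, 𝓑.IsChart g ∧ (∀ᶠ a in germ x v, f a = g a) ∧
      ∃ w, IsWeyl w ∧ ∀ᶠ a in germ x' v', f' a = g (w a) := by
  have hf1 := hf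
  have hf1' := hf'
  obtain ⟨f₀, hf₀, p, hp, rfl⟩ := hf
  obtain ⟨f₁, hf₁, q, hq, rfl⟩ := hf'
  obtain ⟨g, hg, h, h'⟩ := exists_chart_of_mem_atlas hf₀ hf₁ (p x) (p (x + v) - p x)
    (q x') (q (x' + v') - q x')
  have h := (hp.tendsto_germ x v).eventually h
  have h' := (hq.tendsto_germ x' v').eventually h'
  obtain ⟨w, hw, h1, -⟩ := hf1.exists_weyl (isChart_of_mem_atlas hg) h h
  obtain ⟨w', hw', h1', -⟩ := hf1'.exists_weyl (isChart_of_mem_atlas hg) h' h'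
  obtain ⟨u, hu, -, hur⟩ := hw.exists_inverse
  refine ⟨g ∘ w, (isChart_of_mem_atlas hg).comp_weyl hw, h1, u ∘ w', hu.comp hw', ?_⟩
  filter_upwards [h1'] with a ha
  simpa [hur] using ha

namespace AffineBuilding.IsChart

variable {f g : Apt r → B}

/-- Charts that agree on the germ of a chamber agree wherever both are defined. -/
lemma eq_of_eventuallyEq (hf : 𝓑.IsChart f) (hg : 𝓑.IsChart g) {x v : Apt r}
    (hv : Function.Injective (coord v)) (h : ∀ᶠ a in germ x v, f a = g a) {y y' : Apt r}
    (hy : f y = g y') : y = y' := by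
  obtain ⟨w, hw, h1, h2⟩ := hf.exists_weyl hg (h.mono fun a ha => ⟨a, ha.symm⟩)
    (eventually_germ_zero (p := fun a => f a ∈ range g) ⟨y', hy.symm⟩)
  have : w = id := hw.eq_of_eventually isWeyl_id hv
    ((h.and h1).mono fun a ha => hg.injective (ha.2.symm.trans ha.1))
  subst this
  exact hg.injective ((eventually_germ.1 h2).1.symm.trans hy)

/-- If two charts differ by elements of the affine Weyl group on the germs of two chambers, then these
elements are equal. -/
lemma weyl_eq (hf : 𝓑.IsChart f) (hg : 𝓑.IsChart g) {x v x' v' : Apt r} {w w' : Apt r → Apt r}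
    (hw : IsWeyl w) (hw' : IsWeyl w')
    (hv : Function.Injective (coord v)) (h : ∀ᶠ a in germ x v, f a = g (w a))
    (hv' : Function.Injective (coord v')) (h' : ∀ᶠ a in germ x' v', f a = g (w' a)) : w = w' := by
  obtain ⟨u, hu, h1, h2⟩ := hf.exists_weyl hg (h.mono fun a ha => ⟨_, ha.symm⟩)
    (h'.mono fun a ha => ⟨_, ha.symm⟩)
  have e1 : w = u := hw.eq_of_eventually hu hv
    ((h.and h1).mono fun a ha => hg.injective (ha.1.symm.trans ha.2))
  have e2 : w' = u := hw'.eq_of_eventually hu hv'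
    ((h'.and h2).mono fun a ha => hg.injective (ha.1.symm.trans ha.2))
  rw [e1, e2]

end AffineBuilding.IsChart

end Charts

/-! ### Induction along an interval -/

/-- Supremum argument; the start t = 0 is covered by `left`, whose hypothesis is then vacuous. -/
lemma real_induction {p : ℝ → Prop}
    (left : ∀ t ∈ Icc (0 : ℝ) 1, (∀ s, 0 ≤ s → s < t → p s) → p t)
    (right : ∀ t, 0 ≤ t → t < 1 → p t → ∃ ε > 0, ∀ s, t < s → s < t + ε → s ≤ 1 → p s) :
    ∀ t ∈ Icc (0 : ℝ) 1, p t := by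
  have h0 : p 0 := left 0 ⟨le_rfl, zero_le_one⟩ fun s hs hs' => absurd hs' hs.not_gt
  set T : Set ℝ := {t | t ∈ Icc (0 : ℝ) 1 ∧ ∀ s, 0 ≤ s → s ≤ t → p s}
  have hT0 : (0 : ℝ) ∈ T := by
    refine ⟨⟨le_rfl, zero_le_one⟩, fun s hs hs' => ?_⟩
    rwa [le_antisymm hs' hs]
  have hb : BddAbove T := ⟨1, fun t ht => ht.1.2⟩
  have hS0 : 0 ≤ sSup T := le_csSup hb hT0
  have hS1 : sSup T ≤ 1 := csSup_le ⟨0, hT0⟩ fun t ht => ht.1.2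
  have hlt : ∀ s, 0 ≤ s → s < sSup T → p s := by
    intro s hs hs'
    obtain ⟨t, ht, hst⟩ := exists_lt_of_lt_csSup ⟨0, hT0⟩ hs'
    exact ht.2 s hs hst.le
  have hS : p (sSup T) := left _ ⟨hS0, hS1⟩ hlt
  rcases hS1.eq_or_lt with h1 | h1
  · intro t ht
    rcases ht.2.eq_or_lt with h | h
    · rwa [h, ← h1]
    · exact hlt t ht.1 (h1 ▸ h)
  · obtain ⟨ε, hε, h⟩ := right _ hS0 h1 hS
    set u := min 1 (sSup T + ε / 2)
    have hu : sSup T < u := lt_min h1 (by linarith)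
    have : u ∈ T := by
      refine ⟨⟨hS0.trans hu.le, min_le_left _ _⟩, fun s hs hs' => ?_⟩
      rcases lt_trichotomy s (sSup T) with h2 | h2 | h2
      · exact hlt s hs h2
      · rwa [h2]
      · exact h s h2 (by linarith [hs'.trans (min_le_right _ _)]) (hs'.trans (min_le_left _ _))
    exact absurd (le_csSup hb this) hu.not_ge

/-! ### Convexity of the intersection of two apartments -/

section Convexity

variable {r : ℕ} {B : Type*} {𝓑 : AffineBuilding r B} {e f : Apt r → B}

lemma sum_perm_le {θ : Fin r → ℝ} (hθ : Antitone θ) {v : Apt r} (hv : Antitone (coord v))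
    (σ : Equiv.Perm (Fin r)) : ∑ i, θ i * coord v (σ i) ≤ ∑ i, θ i * coord v i :=
  Monovary.sum_mul_comp_perm_le_sum_mul (hθ.monovary hv)

/-- Up to translation `w` permutes the coordinates of `v`, and by rearrangement the decreasing order
maximizes the pairing with the decreasing weight `θ`. -/
lemma IsWeyl.sum_sub_le {w : Apt r → Apt r} (hw : IsWeyl w) {θ : Fin r → ℝ} (hθ : Antitone θ)
    {v : Apt r} (hv : Antitone (coord v)) {x y : Apt r} {c : ℝ} (hc : 0 ≤ c) (hy : y = x + c • v) :
    ∑ i, θ i * coord (w y) i - ∑ i, θ i * coord (w x) i ≤ c * ∑ i, θ i * coord v i := by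
  obtain ⟨σ, t, h⟩ := hw
  subst hy
  calc _ = c * ∑ i, θ i * coord v (σ i) := by
        rw [← Finset.sum_sub_distrib, Finset.mul_sum]
        refine Finset.sum_congr rfl fun i _ => ?_
        simp only [h, coord_add, coord_smul]
        ring
    _ ≤ _ := mul_le_mul_of_nonneg_left (sum_perm_le hθ hv σ) hc

/-- A retraction onto an apartment centred at the germ of a chamber does not increase vectorial
distances. -/
lemma AffineBuilding.IsChart.retraction_le (he : 𝓑.IsChart e) (hf : 𝓑.IsChart f) {z δ : Apt r}
    {ρ : B → Apt r}
    (hρ : ∀ g, 𝓑.IsChart g → (∀ᶠ a in germ z δ, f a = g a) → ∀ y, ρ (g y) = y)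
    {θ : Fin r → ℝ} (hθ : Antitone θ) (x : Apt r) {v : Apt r} (hv : Antitone (coord v)) :
    ∑ i, θ i * coord (ρ (e (x + v))) i - ∑ i, θ i * coord (ρ (e x)) i ≤
      ∑ i, θ i * coord v i := by
  set M := ∑ i, θ i * coord v i
  set ψ : ℝ → ℝ := fun t => ∑ i, θ i * coord (ρ (e (x + t • v))) i
  have key : ∀ t ∈ Icc (0 : ℝ) 1, ψ t - ψ 0 ≤ t * M := by
    refine real_induction (fun t ht hlt => ?_) fun t ht0 ht1 hp => ?_
    · rcases ht.1.eq_or_lt with rfl | h0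
      · simp
      -- A chart containing both the centre of the retraction and the germ of the segment just
      -- before time `t` turns `ρ ∘ e` into a Weyl element there, to which `sum_sub_le` applies. The
      -- other case does the same just after `t`.
      obtain ⟨g, hg, hfg, w, hw, hew⟩ := hf.exists_common he z δ (x + t • v) (-v)
      obtain ⟨ε, hε, h⟩ := eventually_ray hew
      set c := min (ε / 2) t
      have hc : 0 < c := lt_min (by linarith) h0
      have e1 : x + t • v + c • -v = x + (t - c) • v := by rw [sub_smul, smul_neg]; abel
      have h1 := h c hc.le ((min_le_left _ _).trans_lt (by linarith))
      have h2 := h 0 le_rfl hε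
      rw [e1] at h1
      rw [zero_smul, add_zero] at h2
      have h3 := hlt (t - c) (by linarith [min_le_right (ε / 2) t]) (by linarith)
      have h4 := hw.sum_sub_le hθ hv hc.le (x := x + (t - c) • v) (y := x + t • v)
        (by rw [sub_smul]; abel)
      rw [← hρ g hg hfg (w (x + t • v)), ← h2, ← hρ g hg hfg (w (x + (t - c) • v)), ← h1] at h4
      change ψ t - ψ (t - c) ≤ _ at h4
      linarith
    · obtain ⟨g, hg, hfg, w, hw, hew⟩ := hf.exists_common he z δ (x + t • v) v
      obtain ⟨ε, hε, h⟩ := eventually_ray hew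
      refine ⟨ε, hε, fun s hs hs' _ => ?_⟩
      have e1 : x + t • v + (s - t) • v = x + s • v := by rw [sub_smul]; abel
      have h1 := h (s - t) (by linarith) (by linarith)
      have h2 := h 0 le_rfl hε
      rw [e1] at h1
      rw [zero_smul, add_zero] at h2
      have h4 := hw.sum_sub_le hθ hv (sub_nonneg.2 hs.le) e1.symm
      rw [← hρ g hg hfg (w (x + t • v)), ← h2, ← hρ g hg hfg (w (x + s • v)), ← h1] at h4
      change ψ s - ψ t ≤ _ at h4
      linarith
  simpa [ψ] using key 1 ⟨zero_le_one, le_rfl⟩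

/-- Indicators of initial segments of `Fin r` are antitone, and the difference of two consecutive
ones isolates a coordinate. -/
lemma apt_ext_of_antitone {x y : Apt r}
    (h : ∀ θ : Fin r → ℝ, Antitone θ → ∑ i, θ i * coord x i = ∑ i, θ i * coord y i) : x = y := by
  refine apt_ext fun k => ?_
  have h1 := h (fun i => if i ≤ k then 1 else 0) fun i j hij => by
    dsimp only
    split_ifs with h1 h2
    exacts [le_rfl, absurd (hij.trans h1) h2, zero_le_one, le_rfl]
  have h2 := h (fun i => if i < k then 1 else 0) fun i j hij => by
    dsimp only
    split_ifs with h1 h2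
    exacts [le_rfl, absurd (hij.trans_lt h1) h2, zero_le_one, le_rfl]
  have key : ∀ u : Apt r, coord u k = ∑ i, (if i ≤ k then (1 : ℝ) else 0) * coord u i -
      ∑ i, (if i < k then (1 : ℝ) else 0) * coord u i := by
    intro u
    rw [← Finset.sum_sub_distrib, Finset.sum_eq_single k]
    · simp
    · intro i _ hi
      simp [le_iff_lt_or_eq, hi]
    · simp
  rw [key x, key y, h1, h2]

/-- Two charts that agree at two points agree on the hull of these points. -/
theorem AffineBuilding.IsChart.eq_of_between (he : 𝓑.IsChart e) (hf : 𝓑.IsChart f) {a b z : Apt r}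
    (ha : e a = f a) (hb : e b = f b) (hza : Antitone (coord (z - a)))
    (hbz : Antitone (coord (b - z))) : e z = f z := by
  obtain ⟨δ, hδ⟩ := exists_strictAnti_coord r
  -- Construction of the retraction `ρ`: each point is read in a chart that agrees with `f` on a
  -- chamber germ. The germ is based at `z` itself, so that such a chart also agrees with `f` at
  -- `z`.
  have hex : ∀ p : B, ∃ y, ∃ g, 𝓑.IsChart g ∧ (∀ᶠ a in germ z δ, f a = g a) ∧ g y = p := by
    intro p
    obtain ⟨A, hA, hp⟩ := 𝓑.cover p
    obtain ⟨f', hf', rfl⟩ := 𝓑.exists_chart A hA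
    obtain ⟨y, rfl⟩ := hp
    obtain ⟨g, hg, hfg, w, -, h⟩ := hf.exists_common (isChart_of_mem_atlas hf') z δ y 0
    exact ⟨w y, g, hg, hfg, (eventually_germ.1 h).1.symm⟩
  choose ρ G hG hfG hGρ using hex
  have hρ : ∀ g, 𝓑.IsChart g → (∀ᶠ a in germ z δ, f a = g a) → ∀ y, ρ (g y) = y := by
    intro g hg hfg y
    exact (hG (g y)).eq_of_eventuallyEq hg hδ.injective
      (((hfG (g y)).and hfg).mono fun a h => h.1.symm.trans h.2) (hGρ (g y))
  have hf1 : ∀ y, ρ (f y) = y := hρ f hf (Eventually.of_forall fun _ => rfl)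
  -- The displacements a → z and z → b give opposite inequalities for the pairing of `ρ (e z)` with
  -- each antitone weight.
  have hz : ρ (e z) = z := by
    refine apt_ext_of_antitone fun θ hθ => ?_
    have h1 := he.retraction_le hf hρ hθ a hza
    have h2 := he.retraction_le hf hρ hθ z hbz
    rw [add_sub_cancel, ha, hf1] at h1
    rw [add_sub_cancel, hb, hf1] at h2
    simp only [coord_sub, mul_sub, Finset.sum_sub_distrib] at h1 h2
    linarith
  calc e z = G (e z) z := by conv_lhs => rw [← hGρ (e z), hz]
    _ = f z := ((eventually_germ.1 (hfG (e z))).1).symm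

end Convexity

/-! ### Locally dominant paths -/

section Paths

variable {r : ℕ} {B : Type*} {𝓑 : AffineBuilding r B} {c : ℝ → B} {f : Apt r → B} {q g : ℝ → Apt r}

/-- On `J`, the path `c` is given in the chart `f` by `q`, whose increments lie in the open dominant
chamber. -/
structure IsDominantOn (c : ℝ → B) (f : Apt r → B) (q : ℝ → Apt r) (J : Set ℝ) : Prop where
  eq : ∀ s ∈ J, c s = f (q s)
  strictAnti : ∀ s ∈ J, ∀ s' ∈ J, s < s' → StrictAnti (coord (q s' - q s))

lemma IsDominantOn.mono {J J' : Set ℝ} (h : IsDominantOn c f q J) (hJ : J' ⊆ J) :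
    IsDominantOn c f q J' :=
  ⟨fun s hs => h.eq s (hJ hs), fun s hs s' hs' => h.strictAnti s (hJ hs) s' (hJ hs')⟩

lemma IsDominantOn.antitone {J : Set ℝ} (h : IsDominantOn c f q J) {s s' : ℝ} (hs : s ∈ J)
    (hs' : s' ∈ J) (hss' : s ≤ s') : Antitone (coord (q s' - q s)) := by
  rcases hss'.eq_or_lt with rfl | hlt
  · intro i j _
    simp
  · exact (h.strictAnti s hs s' hs' hlt).antitone

lemma strictAnti_coord_add {x y : Apt r} (hx : StrictAnti (coord x)) (hy : StrictAnti (coord y)) :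
    StrictAnti (coord (x + y)) := fun _ _ hij => add_lt_add (hx hij) (hy hij)

lemma IsDominantOn.glue {s u : ℝ} (hq : IsDominantOn c f q (Icc 0 s))
    (hg : IsDominantOn c f g (Icc s u)) (h0 : 0 ≤ s) (hu : s ≤ u) (hqg : q s = g s) :
    IsDominantOn c f (fun x => if x ≤ s then q x else g x) (Icc 0 u) := by
  refine ⟨fun x hx => ?_, fun x hx y hy hxy => ?_⟩
  · split_ifs with h
    · exact hq.eq x ⟨hx.1, h⟩
    · exact hg.eq x ⟨(not_le.1 h).le, hx.2⟩
  · split_ifs with h h' h'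
    · exact hq.strictAnti x ⟨hx.1, h'⟩ y ⟨hy.1, h⟩ hxy
    · exact absurd (hxy.le.trans h) h'
    · have h2 := hg.strictAnti s ⟨le_rfl, hu⟩ y ⟨(not_le.1 h).le, hy.2⟩ (not_le.1 h)
      rcases h'.eq_or_lt with rfl | h'
      · rwa [hqg]
      · have h1 := hq.strictAnti x ⟨hx.1, h'.le⟩ s ⟨h0, le_rfl⟩ h'
        have h3 := strictAnti_coord_add h2 h1
        rwa [hqg, sub_add_sub_cancel] at h3
    · exact hg.strictAnti x ⟨(not_le.1 h').le, hx.2⟩ y ⟨(not_le.1 h).le, hy.2⟩ hxy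

/-- Strictness of the increment leaves room for a full chamber germ at `y`, pointing back, between
`x` and `y`. This makes rigidity applicable at the end of a dominant path. -/
lemma eventually_germ_neg_between {x y δ : Apt r} (hδ : StrictAnti (coord δ))
    (hxy : StrictAnti (coord (y - x))) :
    ∀ᶠ a in germ y (-δ), Antitone (coord (a - x)) ∧ Antitone (coord (y - a)) := by
  refine eventually_germ.2 ⟨⟨hxy.antitone, fun i j _ => by simp⟩, ?_⟩
  obtain ⟨h1, h2⟩ := tendsto_facet_iff.1 (tendsto_id (x := facet y (-δ)))
  have h3 : ∀ᶠ a in facet y (-δ), ∀ i j, i < j → coord (a - x) j < coord (a - x) i := by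
    refine eventually_all.2 fun i => eventually_all.2 fun j => ?_
    by_cases hij : i < j
    · have hc : ∀ k, Tendsto (fun a => coord (a - x) k) (facet y (-δ)) (𝓝 (coord (y - x) k)) :=
        fun k => (tendsto_apt_iff.1 h1 k).sub_const _
      filter_upwards [(hc j).eventually_lt (hc i) (hxy hij)] with a ha _ using ha
    · exact Eventually.of_forall fun a h => absurd h hij
  filter_upwards [h2, h3] with a ha ha'
  have ha' : StrictAnti (coord (a - x)) := fun i j => ha' i j
  refine ⟨ha'.antitone, ?_⟩
  have := neg_mem_vectorialFacet_neg ha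
  rw [neg_neg, id, neg_sub] at this
  exact (strictAnti_of_mem_vectorialFacet hδ this).antitone

lemma AffineBuilding.IsChart.exists_weyl_between {f f' : Apt r → B} (hf : 𝓑.IsChart f)
    (hf' : 𝓑.IsChart f') {a b : Apt r} (ha : f a ∈ range f') (hb : f b ∈ range f') :
    ∃ w, IsWeyl w ∧ ∀ z, Antitone (coord (z - a)) → Antitone (coord (b - z)) →
      f z = f' (w z) := by
  obtain ⟨w, hw, h1, h2⟩ := hf.exists_weyl hf' (eventually_germ_zero (p := fun a => f a ∈ range f') ha)
    (eventually_germ_zero (p := fun a => f a ∈ range f') hb)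
  exact ⟨w, hw, fun z => hf.eq_of_between (hf'.comp_weyl hw) (eventually_germ.1 h1).1
    (eventually_germ.1 h2).1⟩

lemma IsDominantOn.exists_weyl {s : ℝ} (hf : 𝓑.IsChart f) (h : IsDominantOn c f q (Icc 0 s))
    (hs : 0 ≤ s) {f' : Apt r → B} (hf' : 𝓑.IsChart f') (h0 : c 0 ∈ range f')
    (h1 : c s ∈ range f') :
    ∃ w, IsWeyl w ∧ (∀ x ∈ Icc 0 s, c x = f' (w (q x))) ∧
      ∀ z, Antitone (coord (z - q 0)) → Antitone (coord (q s - z)) → f z = f' (w z) := by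
  have m0 : (0 : ℝ) ∈ Icc 0 s := ⟨le_rfl, hs⟩
  have m1 : s ∈ Icc 0 s := ⟨hs, le_rfl⟩
  rw [h.eq _ m0] at h0
  rw [h.eq _ m1] at h1
  obtain ⟨w, hw, hz⟩ := hf.exists_weyl_between hf' h0 h1
  exact ⟨w, hw, fun x hx => (h.eq x hx).trans
    (hz _ (h.antitone m0 hx hx.1) (h.antitone hx m1 hx.2)), hz⟩

lemma IsDominantOn.of_translation {J : Set ℝ} (h : IsDominantOn c f q J) {f' : Apt r → B}
    {w : Apt r → Apt r} {t : Apt r} (hw : ∀ z, w z = z + t) (h' : ∀ x ∈ J, c x = f' (w (q x))) :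
    IsDominantOn c f' (w ∘ q) J :=
  ⟨h', fun s hs s' hs' hlt => by
    simpa only [Function.comp, hw, add_sub_add_right_eq_sub] using h.strictAnti s hs s' hs' hlt⟩

lemma tendsto_facet_right {ε t : ℝ} (hε : 0 < ε) {δ : Apt r} (hδ : StrictAnti (coord δ))
    (hgc : ContinuousWithinAt g (Icc 0 1) t)
    (h : IsDominantOn c f g (Icc 0 1 ∩ Ioo (t - ε) (t + ε))) (h0 : 0 ≤ t) (h1 : t < 1) :
    Tendsto g (𝓝[>] t) (facet (g t) δ) := by
  refine tendsto_facet_iff.2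
    ⟨hgc.mono_left (nhdsWithin_le_of_mem (Icc_mem_nhdsGT_of_mem ⟨h0, h1⟩)), ?_⟩
  filter_upwards [Ioo_mem_nhdsGT (show t < min 1 (t + ε) from lt_min h1 (by linarith))] with s hs
  have hs2 := lt_min_iff.1 hs.2
  exact mem_vectorialFacet_of_strictAnti hδ (h.strictAnti t ⟨⟨h0, h1.le⟩, by linarith, by linarith⟩ s
    ⟨⟨h0.trans hs.1.le, hs2.1.le⟩, by linarith [hs.1], hs2.2⟩ hs.1)

lemma tendsto_facet_left {ε t : ℝ} (hε : 0 < ε) {δ : Apt r} (hδ : StrictAnti (coord δ))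
    (hgc : ContinuousWithinAt g (Icc 0 1) t)
    (h : IsDominantOn c f g (Icc 0 1 ∩ Ioo (t - ε) (t + ε))) (h0 : 0 < t) (h1 : t ≤ 1) :
    Tendsto g (𝓝[<] t) (facet (g t) (-δ)) := by
  refine tendsto_facet_iff.2
    ⟨hgc.mono_left (nhdsWithin_le_of_mem (Icc_mem_nhdsLT_of_mem ⟨h0, h1⟩)), ?_⟩
  filter_upwards [Ioo_mem_nhdsLT (show max 0 (t - ε) < t from max_lt h0 (by linarith))] with s hs
  have hs2 := max_lt_iff.1 hs.1
  have := mem_vectorialFacet_of_strictAnti hδ (h.strictAnti s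
    ⟨⟨hs2.1.le, hs.2.le.trans h1⟩, by linarith, by linarith [hs.2]⟩ t
    ⟨⟨h0.le, h1⟩, by linarith, by linarith⟩ hs.2)
  simpa only [neg_sub] using neg_mem_vectorialFacet_neg this

/-- Take an apartment containing `c 0` and the germ of `e` at `g t` on the past side. It contains
`c` on some [s₁, t], and by convexity on [0, s₂] for s₁ < s₂ < t. The two descriptions overlap on
[s₁, s₂]. -/
lemma IsDominantOn.extend_left {e : Apt r → B} {t ε : ℝ} (ht0 : 0 < t) (ht1 : t ≤ 1) (hε : 0 < ε)
    (he : 𝓑.IsChart e) (hgc : ContinuousWithinAt g (Icc 0 1) t)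
    (hg : IsDominantOn c e g (Icc 0 1 ∩ Ioo (t - ε) (t + ε)))
    (h : ∀ s, 0 ≤ s → s < t → ∃ f, 𝓑.IsChart f ∧ ∃ q, IsDominantOn c f q (Icc 0 s)) :
    ∃ f, 𝓑.IsChart f ∧ ∃ q, IsDominantOn c f q (Icc 0 t) := by
  obtain ⟨δ, hδ⟩ := exists_strictAnti_coord r
  obtain ⟨f₀, hf₀, q₀, hq₀⟩ := h 0 le_rfl ht0
  obtain ⟨f', hf', hef', w₀, -, hw₀⟩ := he.exists_common hf₀ (g t) (-δ) (q₀ 0) 0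
  have hc0 : c 0 ∈ range f' := ⟨w₀ (q₀ 0), by
    rw [hq₀.eq 0 ⟨le_rfl, le_rfl⟩, (eventually_germ.1 hw₀).1]⟩
  obtain ⟨heq, hev⟩ := eventually_germ.1 hef'
  obtain ⟨l, hl, hl'⟩ := mem_nhdsLT_iff_exists_Ioo_subset.1
    ((tendsto_facet_left hε hδ hgc hg ht0 ht1).eventually hev)
  obtain ⟨s₁, hs₁, hs₁t⟩ := exists_between (show max 0 (max (t - ε) l) < t from
    max_lt ht0 (max_lt (by linarith) hl))
  obtain ⟨s₂, hs₂, hs₂t⟩ := exists_between hs₁t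
  rw [max_lt_iff, max_lt_iff] at hs₁
  obtain ⟨hs₁0, hs₁ε, hs₁l⟩ := hs₁
  have hg' : IsDominantOn c f' g (Icc s₁ t) := by
    refine ⟨fun x hx => ?_, (hg.mono fun x hx => ⟨⟨hs₁0.le.trans hx.1, hx.2.trans ht1⟩,
      hs₁ε.trans_le hx.1, by linarith [hx.2]⟩ : IsDominantOn c e g (Icc s₁ t)).strictAnti⟩
    rw [hg.eq x ⟨⟨hs₁0.le.trans hx.1, hx.2.trans ht1⟩, hs₁ε.trans_le hx.1, by linarith [hx.2]⟩]
    rcases hx.2.eq_or_lt with rfl | hxt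
    · exact heq
    · exact hl' ⟨hs₁l.trans_le hx.1, hxt⟩
  obtain ⟨f, hf, q, hq⟩ := h s₂ (hs₁0.trans hs₂).le hs₂t
  have m₁ : s₁ ∈ Icc s₁ t := ⟨le_rfl, hs₁t.le⟩
  have m₂ : s₂ ∈ Icc s₁ t := ⟨hs₂.le, hs₂t.le⟩
  have n₁ : s₁ ∈ Icc 0 s₂ := ⟨hs₁0.le, hs₂.le⟩
  have n₂ : s₂ ∈ Icc 0 s₂ := ⟨(hs₁0.trans hs₂).le, le_rfl⟩
  obtain ⟨w, hw, hwc, -⟩ := hq.exists_weyl hf n₂.1 hf' hc0 ⟨_, (hg'.eq s₂ m₂).symm⟩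
  have e₁ : w (q s₁) = g s₁ := hf'.injective ((hwc s₁ n₁).symm.trans (hg'.eq s₁ m₁))
  have e₂ : w (q s₂) = g s₂ := hf'.injective ((hwc s₂ n₂).symm.trans (hg'.eq s₂ m₂))
  -- The increment over [s₁, s₂] is strictly dominant in both descriptions, so they differ by a
  -- translation and dominance is kept.
  obtain ⟨τ, hτ⟩ := hw.eq_add_of_strictAnti (hq.strictAnti s₁ n₁ s₂ n₂ hs₂)
    (by rw [e₁, e₂]; exact hg'.strictAnti s₁ m₁ s₂ m₂ hs₂)
  exact ⟨f', hf', _, (hq.of_translation hτ hwc).glue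
    (hg'.mono (Icc_subset_Icc_left hs₂.le)) n₂.1 hs₂t.le e₂⟩

/-- The new apartment contains `c 0` and the germ of `e` at `g t` on the future side. Past and
future now meet only at time `t`, so a comparison on an overlap is not available and rigidity is
needed to exclude a fold. -/
lemma IsDominantOn.extend_right {e : Apt r → B} {t ε : ℝ} (ht0 : 0 < t) (ht1 : t < 1) (hε : 0 < ε)
    (he : 𝓑.IsChart e) (hgc : ContinuousWithinAt g (Icc 0 1) t)
    (hg : IsDominantOn c e g (Icc 0 1 ∩ Ioo (t - ε) (t + ε)))
    (hf : 𝓑.IsChart f) (hq : IsDominantOn c f q (Icc 0 t)) :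
    ∃ η > 0, ∀ s, t < s → s < t + η → s ≤ 1 →
      ∃ f, 𝓑.IsChart f ∧ ∃ q, IsDominantOn c f q (Icc 0 s) := by
  obtain ⟨δ, hδ⟩ := exists_strictAnti_coord r
  obtain ⟨s₁, hs₁, hs₁t⟩ := exists_between (show max 0 (t - ε) < t from
    max_lt ht0 (by linarith))
  rw [max_lt_iff] at hs₁
  have m₁ : s₁ ∈ Icc 0 1 ∩ Ioo (t - ε) (t + ε) :=
    ⟨⟨hs₁.1.le, (hs₁t.trans ht1).le⟩, hs₁.2, by linarith⟩
  have m₂ : t ∈ Icc 0 1 ∩ Ioo (t - ε) (t + ε) := ⟨⟨ht0.le, ht1.le⟩, by linarith, by linarith⟩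
  have n₀ : (0 : ℝ) ∈ Icc 0 t := ⟨le_rfl, ht0.le⟩
  have n₁ : s₁ ∈ Icc 0 t := ⟨hs₁.1.le, hs₁t.le⟩
  have n₂ : t ∈ Icc 0 t := ⟨ht0.le, le_rfl⟩
  have hcs₁ := (hq.eq s₁ n₁).symm.trans (hg.eq s₁ m₁)
  have hct := (hq.eq t n₂).symm.trans (hg.eq t m₂)
  have hst := hq.strictAnti s₁ n₁ t n₂ hs₁t
  obtain ⟨w₀, hw₀, hz₀⟩ := hf.exists_weyl_between he ⟨_, hcs₁.symm⟩ ⟨_, hct.symm⟩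
  have e₁ : w₀ (q s₁) = g s₁ := he.injective
    ((hz₀ _ (fun i j _ => by simp) hst.antitone).symm.trans hcs₁)
  have e₂ : w₀ (q t) = g t := he.injective
    ((hz₀ _ hst.antitone (fun i j _ => by simp)).symm.trans hct)
  obtain ⟨τ, hτ⟩ := hw₀.eq_add_of_strictAnti hst
    (by rw [e₁, e₂]; exact hg.strictAnti s₁ m₁ t m₂ hs₁t)
  obtain ⟨f', hf', hef', w₁, -, hw₁⟩ := he.exists_common hf (g t) δ (q 0) 0
  obtain ⟨heq, hev⟩ := eventually_germ.1 hef'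
  have hc0 : c 0 ∈ range f' := ⟨w₁ (q 0), by rw [hq.eq 0 n₀, (eventually_germ.1 hw₁).1]⟩
  have hc1 : c t ∈ range f' := ⟨g t, by rw [hg.eq t m₂, heq]⟩
  obtain ⟨w, hw, hwc, hwz⟩ := hq.exists_weyl hf ht0.le hf' hc0 hc1
  -- The charts `e ∘ w₀` and `f'` differ by `w` on the chamber germ at `q t` pointing back, where
  -- convexity compares both with `f`, and by `w₀` on the opposite germ, where `e` and `f'` agree.
  -- By (B2) one Weyl element serves both germs.
  have hww : w = w₀ := by
    have hneg : Function.Injective (coord (-δ)) := fun i j hij => hδ.injective (neg_injective hij)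
    refine (he.comp_weyl hw₀).weyl_eq hf' (x := q t) (x' := q t) hw hw₀ hneg ?_ hδ.injective ?_
    · filter_upwards [eventually_germ_neg_between hδ hst,
        eventually_germ_neg_between hδ (hq.strictAnti 0 n₀ t n₂ ht0)] with a ha ha'
      exact (hz₀ a ha.1 ha.2).symm.trans (hwz a ha'.1 ha'.2)
    · have := hw₀.tendsto_germ (q t) δ
      rw [e₂, show w₀ (q t + δ) - g t = δ by rw [← e₂, hτ, hτ]; abel] at this
      exact this.eventually hef'
  subst hww
  obtain ⟨u, hu, hu'⟩ := mem_nhdsGT_iff_exists_Ioo_subset.1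
    ((tendsto_facet_right hε hδ hgc hg ht0.le ht1).eventually hev)
  refine ⟨min ε (u - t), lt_min hε (sub_pos.2 hu), fun s hs hs' hs1 => ⟨f', hf', _,
    (hq.of_translation hτ hwc).glue (g := g) ?_ ht0.le hs.le e₂⟩⟩
  have hsε : s < t + ε := by linarith [min_le_left ε (u - t)]
  have hsu : s < u := by linarith [min_le_right ε (u - t)]
  have hsub : Icc t s ⊆ Icc 0 1 ∩ Ioo (t - ε) (t + ε) := fun x hx =>
    ⟨⟨ht0.le.trans hx.1, hx.2.trans hs1⟩, by linarith [hx.1], by linarith [hx.2]⟩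
  refine ⟨fun x hx => ?_, (hg.mono hsub).strictAnti⟩
  rw [hg.eq x (hsub hx)]
  rcases hx.1.eq_or_lt with rfl | hxt
  · exact heq
  · exact hu' ⟨hxt, hx.2.trans_lt hsu⟩

/-- A path which locally lies in apartments, in which its increments are strictly dominant, lies in an
apartment, in which its increments are strictly dominant. -/
theorem exists_isDominantOn_of_local
    (hloc : ∀ t ∈ Icc (0 : ℝ) 1, ∃ ε > 0, ∃ e, 𝓑.IsChart e ∧ ∃ g : ℝ → Apt r,
      ContinuousWithinAt g (Icc 0 1) t ∧
      IsDominantOn c e g (Icc 0 1 ∩ Ioo (t - ε) (t + ε))) :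
    ∃ f, 𝓑.IsChart f ∧ ∃ q, IsDominantOn c f q (Icc 0 1) := by
  refine real_induction (p := fun t => ∃ f, 𝓑.IsChart f ∧ ∃ q, IsDominantOn c f q (Icc 0 t))
    (fun t ht h => ?_) (fun t ht0 ht1 h => ?_) 1 ⟨zero_le_one, le_rfl⟩
  · obtain ⟨ε, hε, e, he, g, hgc, hg⟩ := hloc t ht
    rcases ht.1.eq_or_lt with rfl | ht0
    · refine ⟨e, he, g, hg.mono fun x hx => ?_⟩
      rw [le_antisymm hx.2 hx.1]
      exact ⟨ht, by linarith, by linarith⟩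
    · exact IsDominantOn.extend_left ht0 ht.2 hε he hgc hg h
  · obtain ⟨ε, hε, e, he, g, hgc, hg⟩ := hloc t ⟨ht0, ht1.le⟩
    obtain ⟨f, hf, q, hq⟩ := h
    rcases ht0.eq_or_lt with rfl | ht0
    · exact ⟨ε, hε, fun s hs hs' hs1 => ⟨e, he, g, hg.mono fun x hx =>
        ⟨⟨hx.1, hx.2.trans hs1⟩, by linarith [hx.1], hx.2.trans_lt hs'⟩⟩⟩
    · exact IsDominantOn.extend_right ht0 ht1 hε he hgc hg hf hq

/-- In any chart containing both ends, the function defining a half-apartment is, along the path, a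
difference of two coordinates of `q` plus a constant. It is monotone, hence bounded below by its
value at one of the ends. -/
lemma IsDominantOn.mem_finslerHull (hf : 𝓑.IsChart f) (h : IsDominantOn c f q (Icc 0 1)) {t : ℝ}
    (ht : t ∈ Icc (0 : ℝ) 1) : c t ∈ 𝓑.finslerHull (c 0) (c 1) := by
  intro f' hf' a b ha hb
  obtain ⟨w, ⟨σ, τ, hw⟩, hwc, -⟩ := h.exists_weyl hf zero_le_one
    (AffineBuilding.isChart_of_mem_atlas hf') ⟨a, ha⟩ ⟨b, hb⟩
  have hinj := 𝓑.chart_injective f' hf'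
  have ha' : w (q 0) = a := hinj ((hwc 0 ⟨le_rfl, zero_le_one⟩).symm.trans ha.symm)
  have hb' : w (q 1) = b := hinj ((hwc 1 ⟨zero_le_one, le_rfl⟩).symm.trans hb.symm)
  refine ⟨w (q t), ?_, (hwc t ht).symm⟩
  rintro S ⟨⟨C, hC, rfl⟩, hS⟩ H hH
  have haH := hS (mem_insert a {b}) H hH
  have hbH := hS (mem_insert_of_mem a rfl) H hH
  obtain ⟨i, j, hij, d, rfl⟩ := hC hH
  rw [← ha'] at haH
  rw [← hb'] at hbH
  have h0 := h.antitone ⟨le_rfl, zero_le_one⟩ ht ht.1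
  have h1 := h.antitone ht ⟨zero_le_one, le_rfl⟩ ht.2
  simp only [mem_ofPred_eq, hw] at haH hbH ⊢
  rcases le_total (σ i) (σ j) with hle | hle
  · have := h0 hle
    simp only [coord_sub] at this
    linarith
  · have := h1 hle
    simp only [coord_sub] at this
    linarith

end Paths

/-! ### Non-critical paths are locally dominant -/

open Polynomial in
/-- Vieta's formulas for polynomials whose roots have sum zero. -/
lemma prod_X_sub_C_eq_of_sum_eq_zero {r : ℕ} {R : Type*} [CommRing R] (a : Fin r → R)
    (ha : ∑ i, a i = 0) :
    (Finset.univ.val.map fun i => X - C (a i)).prod = X ^ r + ∑ k : Finset.Icc 2 r,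
      C ((-1) ^ (k : ℕ) * ∑ s ∈ Finset.powersetCard (k : ℕ) (Finset.univ : Finset (Fin r)),
        ∏ i ∈ s, a i) * X ^ (r - (k : ℕ)) := by
  have h := Multiset.prod_X_sub_X_eq_sum_esymm (Finset.univ.val.map a)
  rw [Multiset.map_map] at h
  change (Finset.univ.val.map fun i => X - C (a i)).prod = _ at h
  rw [h]
  simp only [Multiset.card_map, Finset.card_val, Finset.card_univ, Fintype.card_fin,
    Finset.esymm_map_val]
  set F : ℕ → R[X] := fun k => C ((-1) ^ k *
    ∑ s ∈ Finset.powersetCard k (Finset.univ : Finset (Fin r)), ∏ i ∈ s, a i) * X ^ (r - k)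
  have h1 : ∀ k, (-1) ^ k * (C (∑ s ∈ Finset.powersetCard k (Finset.univ : Finset (Fin r)),
      ∏ i ∈ s, a i) * X ^ (r - k)) = F k := by
    intro k
    simp only [F, C_mul, C_pow, C_neg, C_1, mul_assoc]
  simp only [h1]
  rw [Finset.sum_coe_sort (Finset.Icc 2 r) F]
  have h0 : F 0 = X ^ r := by simp [F]
  have hF1 : F 1 = 0 := by simp [F, Finset.powersetCard_one, -map_sum, ha]
  rw [← h0, ← Finset.sum_insert (by simp)]
  symm
  refine Finset.sum_subset (fun k hk => ?_) fun k hk hk' => ?_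
  · simp only [Finset.mem_insert, Finset.mem_Icc, Finset.mem_range] at hk ⊢
    omega
  · simp only [Finset.mem_insert, Finset.mem_Icc, Finset.mem_range] at hk hk'
    rw [show k = 1 by omega, hF1]

section NonCritical

variable {r : ℕ} {X : Type*} [TopologicalSpace X] [ChartedSpace ℂ X]

lemma sum_formOf (g : X → Apt r) (x : X) (v : ℂ) : ∑ i, formOf g x v i = 0 := by
  simp only [formOf, Finset.sum_sub_distrib, ← Finset.mul_sum, ← Complex.ofReal_sum, sum_coord,
    Complex.ofReal_zero, mul_zero, sub_zero]

lemma re_formOf (g : X → Apt r) (x : X) (v : ℂ) (i : Fin r) :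
    (formOf g x v i).re =
      coord (fderiv ℝ (g ∘ (chartAt ℂ x).symm) (chartAt ℂ x x) v) i := by
  simp [formOf]

/-- Coordinates on the apartment sum to zero, and so do the forms; this accounts for the absent term
of degree r - 1 in Vieta's formula. -/
lemma roots_charPoly (φ : HitchinBase X r) (g : X → Apt r) (x : X) (v : ℂ)
    (h : ∀ k : Finset.Icc 2 r, (φ k).eval x v =
      ∑ s ∈ Finset.powersetCard (k : ℕ) (Finset.univ : Finset (Fin r)), ∏ i ∈ s, formOf g x v i) :
    (charPoly φ x v).roots = Finset.univ.val.map (formOf g x v) := by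
  have : charPoly φ x v = ((Finset.univ.val.map (formOf g x v)).map fun a =>
      Polynomial.X - Polynomial.C a).prod := by
    rw [Multiset.map_map]
    refine Eq.trans ?_ (prod_X_sub_C_eq_of_sum_eq_zero (formOf g x v) (sum_formOf g x v)).symm
    simp only [charPoly, h]
  rw [this, Polynomial.roots_multiset_prod_X_sub_C]

lemma hasDerivWithinAt_chart {γ : ℝ → X}
    (hγ : ContMDiffOn 𝓘(ℝ, ℝ) 𝓘(ℝ, ℂ) ∞ γ (Icc 0 1)) {t : ℝ} (ht : t ∈ Icc (0 : ℝ) 1) :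
    HasDerivWithinAt (fun s => chartAt ℂ (γ t) (γ s)) (velocity γ t) (Icc 0 1) t := by
  have h := (contMDiffWithinAt_iff.1 (hγ t ht)).2
  simp only [mfld_simps] at h
  exact (h.differentiableWithinAt (by simp)).hasDerivWithinAt

lemma hasDerivWithinAt_coord {γ : ℝ → X}
    (hγ : ContMDiffOn 𝓘(ℝ, ℝ) 𝓘(ℝ, ℂ) ∞ γ (Icc 0 1)) {t : ℝ} (ht : t ∈ Icc (0 : ℝ) 1)
    {g : X → Apt r}
    (hg : DifferentiableAt ℝ (g ∘ (chartAt ℂ (γ t)).symm) (chartAt ℂ (γ t) (γ t))) (i : Fin r) :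
    HasDerivWithinAt (fun s => coord (g (γ s)) i) (formOf g (γ t) (velocity γ t) i).re
      (Icc 0 1) t := by
  have h1 := hg.hasFDerivAt.comp_hasDerivWithinAt t (hasDerivWithinAt_chart hγ ht)
  let L : Apt r →L[ℝ] ℝ := (EuclideanSpace.proj i).comp (sumZero r).subtypeL
  have h2 := (L.hasFDerivAt).comp_hasDerivWithinAt t h1
  rw [re_formOf]
  have hs : ∀ᶠ s in 𝓝[Icc 0 1] t, γ s ∈ (chartAt ℂ (γ t)).source :=
    (hγ t ht).continuousWithinAt ((chartAt ℂ (γ t)).open_source.mem_nhds (mem_chart_source ℂ (γ t)))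
  refine h2.congr_of_eventuallyEq_of_mem ?_ ht
  filter_upwards [hs] with s hs
  change coord (g (γ s)) i = coord (g ((chartAt ℂ (γ t)).symm (chartAt ℂ (γ t) (γ s)))) i
  rw [(chartAt ℂ (γ t)).left_inv hs]

/-- A curve in the standard apartment whose velocities lie in no wall is strictly dominant after a
permutation of the coordinates. -/
lemma exists_perm_strictAnti {J : Set ℝ} (hJ : Convex ℝ J) {t : ℝ} (ht : t ∈ J) {G : ℝ → Apt r}
    {D : ℝ → Fin r → ℝ} (hG : ∀ s ∈ J, ∀ i, HasDerivWithinAt (fun s => coord (G s) i) (D s i) J s)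
    (hD : ∀ s ∈ J, Function.Injective (D s)) :
    ∃ σ : Equiv.Perm (Fin r), ∀ s ∈ J, ∀ s' ∈ J, s < s' →
      StrictAnti fun i => coord (G s' - G s) (σ i) := by
  set σ := Tuple.sort fun i => -D t i
  refine ⟨σ, fun s hs s' hs' hlt i j hij => ?_⟩
  have hd : ∀ s ∈ J, HasDerivWithinAt (fun s => coord (G s) (σ i) - coord (G s) (σ j))
      (D s (σ i) - D s (σ j)) J s := fun s hs => (hG s hs _).sub (hG s hs _)
  have hne : ∀ s ∈ J, D s (σ i) - D s (σ j) ≠ 0 := fun s hs h =>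
    hij.ne (σ.injective (hD s hs (sub_eq_zero.1 h)))
  have ht0 : 0 ≤ D t (σ i) - D t (σ j) := by
    have := Tuple.monotone_sort (fun i => -D t i) hij.le
    simp only [Function.comp] at this
    linarith
  have hpos : ∀ s ∈ J, 0 < D s (σ i) - D s (σ j) := by
    -- Darboux: a derivative without zeros has constant sign on a convex set, so the order found at
    -- time `t` persists and continuity of the derivative is not needed.
    rcases hasDerivWithinAt_forall_lt_or_forall_gt_of_forall_ne hJ hd hne with h | h
    · exact absurd (h t ht) ht0.not_gt
    · exact h
  have hmono := strictMonoOn_of_hasDerivWithinAt_pos hJ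
    (fun s hs => (hd s hs).continuousWithinAt)
    (fun s hs => (hd s (interior_subset hs)).mono interior_subset)
    (fun s hs => hpos s (interior_subset hs))
  have := hmono hs hs' hlt
  simp only [coord_sub] at this ⊢
  linarith

/-! ### Images of non-critical paths in the building -/

variable {B : Type*} {𝓑 : AffineBuilding r B} {φ : HitchinBase X r} {h : X → B}

theorem AffineBuilding.IsPhiMap.exists_isDominantOn (hφ : 𝓑.IsPhiMap φ h) {γ : ℝ → X}
    (hγ : IsNonCritical φ γ) {t : ℝ} (ht : t ∈ Icc (0 : ℝ) 1) (hreg : γ t ∈ 𝓑.regularLocus h) :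
    ∃ ε > 0, ∃ e, 𝓑.IsChart e ∧ ∃ g : ℝ → Apt r, ContinuousWithinAt g (Icc 0 1) t ∧
      IsDominantOn (h ∘ γ) e g (Icc 0 1 ∩ Ioo (t - ε) (t + ε)) := by
  obtain ⟨U, hU, f, hf, g, hg⟩ := hφ (γ t) hreg
  have hγU : γ ⁻¹' U ∈ 𝓝[Icc 0 1] t := (hγ.smooth t ht).continuousWithinAt hU
  obtain ⟨ε, hε, hεU⟩ := Metric.mem_nhdsWithin_iff.1 hγU
  rw [Real.ball_eq_Ioo, inter_comm] at hεU
  set J := Icc 0 1 ∩ Ioo (t - ε) (t + ε)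
  have hder : ∀ s ∈ J, ∀ i, HasDerivWithinAt (fun s => coord (g (γ s)) i)
      (formOf g (γ s) (velocity γ s) i).re (Icc 0 1) s := fun s hs i =>
    hasDerivWithinAt_coord hγ.smooth hs.1 (hg (γ s) (hεU hs)).2.1 i
  have htJ : t ∈ J := ⟨ht, by linarith, by linarith⟩
  obtain ⟨σ, hσ⟩ := exists_perm_strictAnti ((convex_Icc 0 1).inter (convex_Ioo _ _)) htJ
    (G := g ∘ γ) (fun s hs i => (hder s hs i).mono inter_subset_left) (fun s hs => by
      have := hγ.distinct s hs.1
      rw [roots_charPoly φ g (γ s) _ fun k => (hg (γ s) (hεU hs)).2.2 k _, Multiset.map_map] at this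
      intro i j hij
      exact Multiset.inj_on_of_nodup_map this i (Finset.mem_univ_val i) j (Finset.mem_univ_val j) hij)
  obtain ⟨w, hw, hwσ⟩ := isWeyl_perm σ
  obtain ⟨w', hw', hl, -⟩ := hw.exists_inverse
  refine ⟨ε, hε, f ∘ w', (AffineBuilding.isChart_of_mem_atlas hf).comp_weyl hw', w ∘ g ∘ γ, ?_,
    fun s hs => ?_, fun s hs s' hs' hlt => ?_⟩
  · exact (hw.continuous.tendsto _).comp
      (tendsto_apt_iff.2 fun i => (hder t htJ i).continuousWithinAt)
  · simp only [Function.comp, hl]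
    exact (hg (γ s) (hεU hs)).1
  · simpa only [Function.comp, StrictAnti, coord_sub, hwσ] using hσ s hs s' hs' hlt

theorem AffineBuilding.IsPhiMap.exists_chart (hφ : 𝓑.IsPhiMap φ h) {γ : ℝ → X}
    (hγ : IsNonCritical φ γ) (hreg : ∀ t ∈ Icc (0 : ℝ) 1, γ t ∈ 𝓑.regularLocus h) :
    ∃ f, 𝓑.IsChart f ∧ ∃ q, IsDominantOn (h ∘ γ) f q (Icc 0 1) :=
  exists_isDominantOn_of_local fun t ht => hφ.exists_isDominantOn hγ ht (hreg t ht)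

lemma AffineBuilding.exists_finslerHull_subset (x y : B) :
    ∃ A ∈ 𝓑.apartments, 𝓑.finslerHull x y ⊆ A := by
  obtain ⟨A, hA, hx⟩ := 𝓑.cover x
  obtain ⟨f, hf, rfl⟩ := 𝓑.exists_chart A hA
  obtain ⟨A', hA', hy⟩ := 𝓑.cover y
  obtain ⟨f', hf', rfl⟩ := 𝓑.exists_chart A' hA'
  obtain ⟨a, rfl⟩ := hx
  obtain ⟨b, rfl⟩ := hy
  -- Direction 0 at both points: (B1) for two points. The Finsler hull lies in every apartment
  -- containing both, so one such apartment suffices.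
  obtain ⟨g, hg, h, h'⟩ := exists_chart_of_mem_atlas hf hf' a 0 b 0
  obtain ⟨a', ha'⟩ := (eventually_germ.1 h).1
  obtain ⟨b', hb'⟩ := (eventually_germ.1 h').1
  exact ⟨range g, 𝓑.range_chart g hg, fun z hz => image_subset_range g _ (hz g hg a' b' ha' hb')⟩

end NonCritical

end HarmonicBuilding

theorem mainTheorem7 {r : ℕ} {X : Type*} [TopologicalSpace X] [T2Space X] [ChartedSpace ℂ X]
    [IsManifold 𝓘(ℂ, ℂ) 1 X] {B : Type*} (𝓑 : HarmonicBuilding.AffineBuilding r B)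
    (φ : HarmonicBuilding.HitchinBase X r) (h : X → B) (hh : 𝓑.IsHarmonicPhiMap φ h) :
    (∀ γ : ℝ → X, HarmonicBuilding.IsNonCritical φ γ →
      (∀ t ∈ Set.Icc (0 : ℝ) 1, γ t ∈ 𝓑.regularLocus h) →
      ∃ A ∈ 𝓑.apartments, (h ∘ γ) '' Set.Icc 0 1 ⊆ A) ∧
    (∀ P ∈ 𝓑.regularLocus h, ∀ Q ∈ 𝓑.regularLocus h,
      h '' 𝓑.nonCriticalRegion φ h P Q ⊆ 𝓑.finslerHull (h P) (h Q) ∧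
      ∃ A ∈ 𝓑.apartments, h '' 𝓑.nonCriticalRegion φ h P Q ⊆ A) := by
  refine ⟨fun γ hγ hreg => ?_, fun P _ Q _ => ?_⟩
  · obtain ⟨f, hf, q, hq⟩ := hh.phiMap.exists_chart hγ hreg
    refine ⟨Set.range f, hf.range_mem, ?_⟩
    rintro _ ⟨t, ht, rfl⟩
    exact ⟨q t, (hq.eq t ht).symm⟩
  · have key : h '' 𝓑.nonCriticalRegion φ h P Q ⊆ 𝓑.finslerHull (h P) (h Q) := by
      rintro _ ⟨_, ⟨γ, hγ, hreg, rfl, rfl, t, ht, rfl⟩, rfl⟩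
      obtain ⟨f, hf, q, hq⟩ := hh.phiMap.exists_chart hγ hreg
      exact hq.mem_finslerHull hf ht
    obtain ⟨A, hA, hsub⟩ := HarmonicBuilding.AffineBuilding.exists_finslerHull_subset (𝓑 := 𝓑)
      (h P) (h Q)
    exact ⟨key, A, hA, key.trans hsub⟩
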